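/- **Setting.** Let $d,m\ge 1$ be integers, $p\in[1,\infty]$ with dual exponent $p^\star$ ($1/p+1/p^\star=1$, $1/\infty=0$), and $\epsilon\ge 0$. Let $\mathcal D$ be a probability distribution on $\mathbb R^d\times\{\pm1\}$ that is labeled robustly by a linear teacher $\mathbf w^\star\in\mathbb R^d$: for $\mathcal D$-almost every $(\mathbf x,y)$, $y=\mathrm{sgn}(\langle\mathbf w^\star,\mathbf x'\rangle)$ for all $\mathbf x'$ with $\|\mathbf x'-\mathbf x\|_p\le\epsilon$ (here $\mathrm{sgn}(0)=0$). Let $S=\{(\mathbf x_1,y_1),\dots,(\mathbf x_m,y_m)\}\sim\mathcal D^m$. Define the robust 0-1 risk of $\mathbf x\mapsto\langle\mathbf w,\mathbf x\rangle$ as $$\tilde L_{\mathcal D,01}(\mathbf w)=\mathbb E_{(\mathbf x,y)\sim\mathcal D}\Big[\max_{\|\mathbf x'-\mathbf x\|_p\le\epsilon}\mathbb 1\{y\langle\mathbf w,\mathbf x'\rangle\le 0\}\Big],$$ the robust margin on the sample as $$\gamma_S(\mathbf u)=\min_{i\in[m]}\ \min_{\|\mathbf x_i'-\mathbf x_i\|_p\le\epsilon}y_i\langle\mathbf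 u,\mathbf x_i'\rangle ,$$ and, for $r\in\{1,2\}$, the set of robust max-margin vectors as $M_r(S)=\arg\max_{\|\mathbf u\|_r\le1}\gamma_S(\mathbf u)$. A vector $\mathbf w$ is called a *robust max-margin interpolator* for $r$ if $\mathbf w=c\,\mathbf u$ for some $c>0$ and $\mathbf u\in M_r(S)$, and $\gamma_S(\mathbf w)\ge1$ (that is, its robust empirical ramp loss, with ramp $l(t)=\min(1,\max(0,1-t))$, is zero). Put $$B_1=\frac{2}{\sqrt m}\Big(\max_i\|\mathbf x_i\|_\infty\,\|\mathbf w^\star\|_1\sqrt{2\log(2d)}+\epsilon\|\mathbf w^\star\|_1\Big)+3\sqrt{\frac{\log(2/\delta)}{2m}},$$ $$B_2=\frac{2}{\sqrt m}\Big(\max_i\|\mathbf x_i\|_2\,\|\mathbf w^\star\|_2+\epsilon\|\mathbf w^\star\|_2\,d^{\max(1/p^\star-1/2,\,0)}\Big)+3\sqrt{\frac{\log(2/\delta)}{2m}} .$$ **Proposition (generalization bound for robust interpolators).** For every $\delta>0$ and each $r\in\{1,2\}$: 1. With probability at least $1-\delta$ over the draw of $S$, every robust max-margin interpolator $\mathbf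 w$ for $r$ with $\|\mathbf w\|_r\le\|\mathbf w^\star\|_r$ satisfies $\tilde L_{\mathcal D,01}(\mathbf w)\le B_r$. 2. If moreover the teacher is scaled to have robust margin at least $1$, i.e. for $\mathcal D$-almost every $(\mathbf x,y)$ one has $y\langle\mathbf w^\star,\mathbf x'\rangle\ge1$ for all $\mathbf x'$ with $\|\mathbf x'-\mathbf x\|_p\le\epsilon$, then, with probability at least $1-\delta$ over the draw of $S$, every $\mathbf w\in M_r(S)$ with $\|\mathbf w\|_r\le\|\mathbf w^\star\|_r$ satisfies $\tilde L_{\mathcal D,01}(\mathbf w)\le B_r$. -/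

import Mathlib

open MeasureTheory

noncomputable section

/-- The two labels `+1` and `-1`, as real numbers. -/
abbrev Label : Type := {y : ℝ // y = 1 ∨ y = -1}

/-- A labeled example: a point of `ℝ^d` together with a label. -/
abbrev Example (d : ℕ) : Type := (Fin d → ℝ) × Label

/-- The `ℓ_p` norm of a vector of `ℝ^d`, for an exponent `p ∈ [1, ∞]`. -/
def ellNorm {d : ℕ} (p : ENNReal) (x : Fin d → ℝ) : ℝ := ‖WithLp.toLp p x‖

/-- The closed `ℓ_p` ball of radius `ε` about `x`: the admissible perturbations of `x`. -/
def perturbations {d : ℕ} (p : ENNReal) (ε : ℝ) (x : Fin d → ℝ) : Set (Fin d → ℝ) :=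
  {x' | ellNorm p (x' - x) ≤ ε}

open Classical in
/-- The robust 0-1 risk of `x ↦ ⟨w, x⟩`: the expectation of the maximum, over the perturbations `x'`
of `x`, of the indicator of `y ⟨w, x'⟩ ≤ 0`. -/
def robustRisk01 {d : ℕ} (D : Measure (Example d)) (p : ENNReal) (ε : ℝ) (w : Fin d → ℝ) : ℝ :=
  ∫ z, (⨆ x' : perturbations p ε z.1,
    if (z.2 : ℝ) * (w ⬝ᵥ (x' : Fin d → ℝ)) ≤ 0 then (1 : ℝ) else 0) ∂D

/-- The robust margin of `u` on the dataset `S`: the minimum over `i` and over the perturbations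
`x'` of `x_i` of `y_i ⟨u, x'⟩`. -/
def robustMargin {d m : ℕ} (p : ENNReal) (ε : ℝ) (S : Fin m → Example d) (u : Fin d → ℝ) : ℝ :=
  ⨅ i : Fin m, ⨅ x' : perturbations p ε (S i).1, ((S i).2 : ℝ) * (u ⬝ᵥ (x' : Fin d → ℝ))

/-- The maximizers of the robust margin over the unit `ℓ_r` ball. -/
def maxMarginVectors {d m : ℕ} (r p : ENNReal) (ε : ℝ) (S : Fin m → Example d) :
    Set (Fin d → ℝ) :=
  {u | ellNorm r u ≤ 1 ∧ IsMaxOn (robustMargin p ε S) {v | ellNorm r v ≤ 1} u}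

/-- Robust max-margin interpolators: positive multiples of maximizers of the robust margin, scaled so
that all perturbed training points have margin at least `1` (zero robust ramp loss), and with
`ℓ_r` norm at most that of `wstar`. -/
def maxMarginInterpolators {d m : ℕ} (r p : ENNReal) (ε : ℝ) (wstar : Fin d → ℝ)
    (S : Fin m → Example d) : Set (Fin d → ℝ) :=
  {w | ellNorm r w ≤ ellNorm r wstar ∧ 1 ≤ robustMargin p ε S w ∧
    ∃ u ∈ maxMarginVectors r p ε S, ∃ c : ℝ, 0 < c ∧ w = c • u}

/-- Maximizers of the robust margin over the unit `ℓ_r` ball with `ℓ_r` norm at most that of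
`wstar`. -/
def maxMarginUnit {d m : ℕ} (r p : ENNReal) (ε : ℝ) (wstar : Fin d → ℝ)
    (S : Fin m → Example d) : Set (Fin d → ℝ) :=
  {w | ellNorm r w ≤ ellNorm r wstar ∧ w ∈ maxMarginVectors r p ε S}

/-- The right-hand side of the generalization bound for `r = 1`. -/
def robustBoundOne {d m : ℕ} (ε : ℝ) (wstar : Fin d → ℝ) (δ : ℝ) (S : Fin m → Example d) : ℝ :=
  2 / √(m : ℝ) * ((⨆ i : Fin m, ellNorm ⊤ (S i).1) * ellNorm 1 wstar * √(2 * Real.log (2 * d))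
      + ε * ellNorm 1 wstar)
    + 3 * √(Real.log (2 / δ) / (2 * m))

/-- The right-hand side of the generalization bound for `r = 2`; `q` is the exponent conjugate to
that of the perturbations, and `1 / q` is `0` for `q = ∞`. -/
def robustBoundTwo {d m : ℕ} (q : ENNReal) (ε : ℝ) (wstar : Fin d → ℝ) (δ : ℝ)
    (S : Fin m → Example d) : ℝ :=
  2 / √(m : ℝ) * ((⨆ i : Fin m, ellNorm 2 (S i).1) * ellNorm 2 wstar
      + ε * ellNorm 2 wstar * (d : ℝ) ^ max (1 / q.toReal - 1 / 2) 0)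
    + 3 * √(Real.log (2 / δ) / (2 * m))

/-- `P S` holds with probability at least `a` over the draw of `m` independent examples from `D`. -/
def HoldsWithProb {d : ℕ} (m : ℕ) (D : Measure (Example d)) (a : ℝ)
    (P : (Fin m → Example d) → Prop) : Prop :=
  ∃ E : Set (Fin m → Example d), MeasurableSet E ∧
    ENNReal.ofReal a ≤ Measure.pi (fun _ : Fin m => D) E ∧ ∀ S ∈ E, P S

end

/-! Write a perturbed point as `x' = x - y • v` with `‖v‖_p ≤ ε`. Then `y⟨w, x'⟩ = y⟨w, x⟩ - ⟨w,
v⟩`, so the worst perturbation lowers the margin by `a(w) = sup ⟨w, v⟩`, which depends on neither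
`x` nor `y`. By Hölder `0 ≤ a(w) ≤ ε‖w‖_q`, with `q` conjugate to `p`. The robust problem therefore
becomes an ordinary one for the functions `y⟨w, x⟩ - a`, with `w` in an `ℓ_r` ball and `a` a free
parameter in a bounded interval.

The ramp loss dominates the 0-1 loss, is 1-Lipschitz, and vanishes on the sample as soon as the
robust margin is at least 1. It remains to bound its uniform deviation. Symmetrization bounds the
mean deviation by twice the mean Rademacher average (`integral_ciSup_deviation_le`). A single use of
McDiarmid's inequality, on the deviation minus twice the empirical average, makes this a
data-dependent bound (`measure_exists_deviation_le`). Monotone limits and density extend it to the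
whole class. Contraction removes the ramp.

For the remaining functions, duality of `ℓ_r` reduces the linear part to the mean norm of a
Rademacher sum of the sample points: Massart's lemma for `r = 1`, orthogonality of the signs for `r
= 2`. The offset contributes the mean of `|∑ σ i|`, at most `√m`.

For the second claim, a maximizer on the unit ball rescaled by `‖w⋆‖_r` has robust margin at least 1
(`one_le_robustMargin_smul`), and the 0-1 risk ignores positive scaling. -/

/-! ### McDiarmid's inequality -/

/-- The moment generating function bound behind McDiarmid's inequality. -/
theorem integral_exp_mul_sub_integral_le {Z : Type*} [MeasurableSpace Z] (μ : Measure Z)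
    [IsProbabilityMeasure μ] {c : ℝ} (hc : 0 ≤ c) (C t : ℝ) (n : ℕ) :
    ∀ F : (Fin n → Z) → ℝ, Measurable F → (∀ S, |F S| ≤ C) →
      (∀ S i z, |F (Function.update S i z) - F S| ≤ c) →
      ∫ S, Real.exp (t * (F S - ∫ S, F S ∂Measure.pi fun _ => μ)) ∂Measure.pi (fun _ => μ)
        ≤ Real.exp (n * ((c / 2) ^ 2 * t ^ 2 / 2)) := by
  induction n with
  | zero =>
    intro F _ _ _
    have hF : ∀ S, F S = F default := fun S => by rw [Subsingleton.elim S default]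
    simp only [hF, integral_const]
    simp
  | succ n ih =>
    intro F hFm hFb hFd
    have he := (measurePreserving_piFinSuccAbove (fun _ : Fin (n + 1) => μ) 0).symm
    have hsymm : ∀ q : Z × (Fin n → Z), (MeasurableEquiv.piFinSuccAbove (fun _ => Z) 0).symm q =
        (Fin.cons q.1 q.2 : Fin (n + 1) → Z) := fun q =>
      Fin.insertNth_zero' q.1 q.2
    have hcons : Measurable (fun q : Z × (Fin n → Z) => (Fin.cons q.1 q.2 : Fin (n + 1) → Z)) :=
      (funext hsymm : ⇑(MeasurableEquiv.piFinSuccAbove (fun _ : Fin (n + 1) => Z) 0).symm = _) ▸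
        he.measurable
    have hint : ∀ G : (Fin (n + 1) → Z) → ℝ, ∫ S, G S ∂Measure.pi (fun _ => μ) =
        ∫ q : Z × (Fin n → Z), G (Fin.cons q.1 q.2) ∂μ.prod (Measure.pi fun _ => μ) := fun G => by
      rw [← he.integral_comp' G]
      simp only [hsymm]
    have hbdd : ∀ G : Z × (Fin n → Z) → ℝ, Measurable G → ∀ K, (∀ q, |G q| ≤ K) →
        Integrable G (μ.prod (Measure.pi fun _ => μ)) := fun G hG K hK =>
      Integrable.of_bound hG.aestronglyMeasurable K (Filter.Eventually.of_forall hK)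
    set F' : Z × (Fin n → Z) → ℝ := fun q => F (Fin.cons q.1 q.2) with hF'
    have hF'm : Measurable F' := hFm.comp hcons
    have hF'i := hbdd F' hF'm C (fun q => hFb _)
    -- Averaging out the first coordinate preserves measurability, boundedness and bounded
    -- differences, so the induction hypothesis applies to `g`, which has the same mean as `F`.
    set g : (Fin n → Z) → ℝ := fun T => ∫ z, F' (z, T) ∂μ with hg
    have hgm : Measurable g := (hF'm.stronglyMeasurable.integral_prod_left' (μ := μ)).measurable
    have hFz : ∀ T, Measurable fun z => F' (z, T) := fun T => by fun_prop
    have hFzi : ∀ T, Integrable (fun z => F' (z, T)) μ := fun T =>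
      Integrable.of_bound (hFz T).aestronglyMeasurable C
        (Filter.Eventually.of_forall fun z => hFb _)
    have hgb : ∀ T, |g T| ≤ C := fun T => by
      have := norm_integral_le_of_norm_le_const (μ := μ) (f := fun z => F' (z, T)) (C := C)
        (Filter.Eventually.of_forall fun z => hFb _)
      simpa using this
    have hgd : ∀ T i z, |g (Function.update T i z) - g T| ≤ c := fun T i z => by
      have := norm_integral_le_of_norm_le_const (μ := μ)
        (f := fun x => F' (x, Function.update T i z) - F' (x, T)) (C := c)
        (Filter.Eventually.of_forall fun x => by
          simp only [hF', Fin.cons_update]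
          exact hFd _ _ _)
      rw [integral_sub (hFzi _) (hFzi _)] at this
      simpa using this
    have hmean : ∫ S, F S ∂Measure.pi (fun _ => μ) = ∫ T, g T ∂Measure.pi (fun _ => μ) := by
      rw [hint]
      exact integral_prod_symm F' hF'i
    set M := ∫ T, g T ∂Measure.pi (fun _ : Fin n => μ) with hM
    -- With the other coordinates frozen, the values lie in an interval of length `c` starting at
    -- their infimum, so Hoeffding's lemma gives the variance proxy `(c / 2) ^ 2`.
    have hinner : ∀ T, ∫ z, Real.exp (t * (F' (z, T) - g T)) ∂μ ≤
        Real.exp ((c / 2) ^ 2 * t ^ 2 / 2) := fun T => by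
      obtain ⟨z₀⟩ : Nonempty Z := nonempty_of_isProbabilityMeasure μ
      have hdiff : ∀ z z', F' (z, T) ≤ F' (z', T) + c := fun z z' => by
        have := hFd (Fin.cons z' T) 0 z
        rw [Fin.update_cons_zero] at this
        linarith [(abs_le.1 this).2]
      have hbb : BddBelow (Set.range fun z => F' (z, T)) :=
        ⟨-C, by rintro _ ⟨z, rfl⟩; exact (abs_le.1 (hFb _)).1⟩
      have : Nonempty Z := ⟨z₀⟩
      have key := ProbabilityTheory.hasSubgaussianMGF_of_mem_Icc (μ := μ)
        (X := fun z => F' (z, T)) (a := ⨅ z, F' (z, T)) (b := (⨅ z, F' (z, T)) + c)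
        (hFz T).aemeasurable (Filter.Eventually.of_forall fun z => ⟨ciInf_le hbb z, by
          have : F' (z, T) - c ≤ ⨅ z, F' (z, T) := le_ciInf fun z' => by linarith [hdiff z z']
          linarith⟩)
      have := key.mgf_le t
      simpa [ProbabilityTheory.mgf, abs_of_nonneg hc] using this
    have hexp : ∀ q : Z × (Fin n → Z), Real.exp (t * (F' q - M)) =
        Real.exp (t * (F' q - g q.2)) * Real.exp (t * (g q.2 - M)) := fun q => by
      rw [← Real.exp_add]; ring_nf
    have hMb : |M| ≤ C := by
      have := norm_integral_le_of_norm_le_const (μ := Measure.pi fun _ : Fin n => μ) (f := g)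
        (C := C) (Filter.Eventually.of_forall fun z => hgb _)
      simpa using this
    have hexpb : ∀ a b : ℝ, |a| ≤ C → |b| ≤ C →
        |Real.exp (t * (a - b))| ≤ Real.exp (|t| * (C + C)) := fun a b ha hb => by
      rw [abs_of_pos (Real.exp_pos _), Real.exp_le_exp]
      calc t * (a - b) ≤ |t * (a - b)| := le_abs_self _
        _ = |t| * |a - b| := abs_mul _ _
        _ ≤ |t| * (C + C) := by gcongr; exact (abs_sub _ _).trans (by gcongr)
    rw [hmean, hint]
    change ∫ q, Real.exp (t * (F' q - M)) ∂_ ≤ _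
    rw [integral_prod_symm _ (hbdd _ (by fun_prop) _ fun q => hexpb _ _ (hFb _) hMb)]
    have hgi : Integrable (fun T => Real.exp (t * (g T - M))) (Measure.pi fun _ => μ) :=
      Integrable.of_bound (by fun_prop) _ (Filter.Eventually.of_forall fun T =>
        hexpb _ _ (hgb T) hMb)
    calc ∫ T, ∫ z, Real.exp (t * (F' (z, T) - M)) ∂μ ∂Measure.pi (fun _ => μ)
        ≤ ∫ T, Real.exp ((c / 2) ^ 2 * t ^ 2 / 2) * Real.exp (t * (g T - M))
            ∂Measure.pi (fun _ => μ) := by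
          refine integral_mono_of_nonneg (Filter.Eventually.of_forall fun T =>
            integral_nonneg fun z => (Real.exp_pos _).le) (hgi.const_mul _)
            (Filter.Eventually.of_forall fun T => ?_)
          simp only [hexp, integral_mul_const]
          exact mul_le_mul_of_nonneg_right (hinner T) (Real.exp_pos _).le
      _ ≤ Real.exp ((c / 2) ^ 2 * t ^ 2 / 2) * Real.exp (n * ((c / 2) ^ 2 * t ^ 2 / 2)) := by
          rw [integral_const_mul]
          gcongr
          exact ih g hgm hgb hgd
      _ = _ := by rw [← Real.exp_add]; push_cast; ring_nf

/-- **McDiarmid's inequality** for independent identically distributed variables. -/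
theorem measure_ge_le_of_bounded_differences {Z : Type*} [MeasurableSpace Z] (μ : Measure Z)
    [IsProbabilityMeasure μ] {c C : ℝ} (hc : 0 < c) {n : ℕ} (hn : 0 < n) (F : (Fin n → Z) → ℝ)
    (hFm : Measurable F) (hFb : ∀ S, |F S| ≤ C)
    (hFd : ∀ S i z, |F (Function.update S i z) - F S| ≤ c) {s : ℝ} (hs : 0 ≤ s) :
    (Measure.pi fun _ => μ).real {S | s ≤ F S - ∫ S, F S ∂Measure.pi fun _ => μ} ≤
      Real.exp (-(2 * s ^ 2 / (n * c ^ 2))) := by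
  set M := ∫ S, F S ∂Measure.pi (fun _ : Fin n => μ)
  -- The minimizer of the Chernoff exponent `-t * s + n * c ^ 2 * t ^ 2 / 8`.
  set t : ℝ := 4 * s / (n * c ^ 2)
  have hn' : (0 : ℝ) < n := by exact_mod_cast hn
  have ht : 0 ≤ t := by positivity
  have hi : Integrable (fun S => Real.exp (t * (F S - M))) (Measure.pi fun _ : Fin n => μ) :=
    Integrable.of_bound (by fun_prop) (Real.exp (t * (C - M)))
      (Filter.Eventually.of_forall fun S => by
        rw [Real.norm_of_nonneg (Real.exp_pos _).le, Real.exp_le_exp]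
        gcongr
        exact (abs_le.1 (hFb S)).2)
  refine (ProbabilityTheory.measure_ge_le_exp_mul_mgf s ht hi).trans ?_
  calc _ ≤ Real.exp (-t * s) * Real.exp (n * ((c / 2) ^ 2 * t ^ 2 / 2)) := by
        gcongr
        exact integral_exp_mul_sub_integral_le μ hc.le C t n F hFm hFb hFd
    _ = _ := by
        rw [← Real.exp_add]
        congr 1
        simp only [t]
        field_simp
        ring

/-! ### Rademacher averages, contraction and symmetrization -/

/-- The value `±1` of a Rademacher variable, encoded by a Boolean. -/
def rademacherSign (b : Bool) : ℝ := if b then 1 else -1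

theorem rademacherSign_true : rademacherSign true = 1 := rfl

theorem rademacherSign_false : rademacherSign false = -1 := rfl

theorem rademacherSign_not (b : Bool) : rademacherSign (!b) = -rademacherSign b := by
  cases b <;> simp [rademacherSign]

theorem abs_rademacherSign (b : Bool) : |rademacherSign b| = 1 := by
  cases b <;> simp [rademacherSign]

/-- The average over independent signs of the supremum over `k` of `∑ i, σ i * t i k`: the
empirical Rademacher complexity, not divided by the sample size. -/
noncomputable def rademacherAverage {ι : Type*} {n : ℕ} (t : Fin n → ι → ℝ) : ℝ :=
  (∑ σ : Fin n → Bool, ⨆ k, ∑ i, rademacherSign (σ i) * t i k) / 2 ^ n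

theorem rademacherAverage_le_of_forall {ι : Type*} [Nonempty ι] {n : ℕ} {t : Fin n → ι → ℝ}
    {B : (Fin n → Bool) → ℝ}
    (h : ∀ σ k, ∑ i, rademacherSign (σ i) * t i k ≤ B σ) :
    rademacherAverage t ≤ (∑ σ, B σ) / 2 ^ n := by
  unfold rademacherAverage
  exact div_le_div_of_nonneg_right (Finset.sum_le_sum fun σ _ => ciSup_le (h σ)) (by positivity)

section Finite

variable {ι : Type*} [Finite ι]

theorem le_ciSup_of_finite (f : ι → ℝ) (k : ι) : f k ≤ ⨆ k, f k :=
  le_ciSup (Set.finite_range f).bddAbove k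

theorem abs_ciSup_sub_ciSup_le [Nonempty ι] {f g : ι → ℝ} {c : ℝ} (h : ∀ k, |f k - g k| ≤ c) :
    |(⨆ k, f k) - ⨆ k, g k| ≤ c := by
  rw [abs_sub_le_iff]
  constructor <;> rw [sub_le_iff_le_add] <;> refine ciSup_le fun k => ?_
  · linarith [(abs_sub_le_iff.1 (h k)).1, le_ciSup_of_finite g k]
  · linarith [(abs_sub_le_iff.1 (h k)).2, le_ciSup_of_finite f k]

theorem abs_ciSup_le_of_finite [Nonempty ι] {f : ι → ℝ} {c : ℝ} (h : ∀ k, |f k| ≤ c) :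
    |⨆ k, f k| ≤ c := by
  simpa using abs_ciSup_sub_ciSup_le (f := f) (g := fun _ => 0) (by simpa using h)

/-- Let `k` and `l` attain the two suprema on the left. The Lipschitz bound replaces `φ (t k) - φ (t
l)` by `|t k - t l|`, and the sign of `t k - t l` decides which of `k`, `l` is used in which
supremum on the right. -/
theorem ciSup_add_ciSup_contraction [Nonempty ι] (B t : ι → ℝ) {φ : ℝ → ℝ}
    (hφ : ∀ a b, |φ a - φ b| ≤ |a - b|) :
    (⨆ k, (B k + φ (t k))) + ⨆ k, (B k - φ (t k)) ≤
      (⨆ k, (B k + t k)) + ⨆ k, (B k - t k) := by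
  obtain ⟨k, hk⟩ := exists_eq_ciSup_of_finite (f := fun k => B k + φ (t k))
  obtain ⟨l, hl⟩ := exists_eq_ciSup_of_finite (f := fun k => B k - φ (t k))
  rw [← hk, ← hl]
  have h := (le_abs_self _).trans (hφ (t k) (t l))
  have hk₁ := le_ciSup_of_finite (fun k => B k + t k) k
  have hk₂ := le_ciSup_of_finite (fun k => B k - t k) k
  have hl₁ := le_ciSup_of_finite (fun k => B k + t k) l
  have hl₂ := le_ciSup_of_finite (fun k => B k - t k) l
  rcases abs_cases (t k - t l) with ⟨h', _⟩ | ⟨h', _⟩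
  · beta_reduce at *; linarith
  · beta_reduce at *; linarith

theorem sum_signs_succ {n : ℕ} (f : (Fin (n + 1) → Bool) → ℝ) :
    ∑ σ, f σ = ∑ σ : Fin n → Bool, (f (Fin.cons true σ) + f (Fin.cons false σ)) := by
  rw [← (Fin.consEquiv fun _ => Bool).sum_comp, Fintype.sum_prod_type_right]
  simp [Fin.consEquiv]

/-- One coordinate is contracted at a time. The arbitrary offset `A` absorbs `± φ (t 0 k)` while the
induction hypothesis treats the other coordinates; the two values of the first sign are then paired
by the two-point inequality. -/
theorem sum_ciSup_contraction [Nonempty ι] {φ : ℝ → ℝ} (hφ : ∀ a b, |φ a - φ b| ≤ |a - b|) (n : ℕ) :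
    ∀ (A : ι → ℝ) (t : Fin n → ι → ℝ),
      ∑ σ : Fin n → Bool, ⨆ k, (A k + ∑ i, rademacherSign (σ i) * φ (t i k)) ≤
        ∑ σ : Fin n → Bool, ⨆ k, (A k + ∑ i, rademacherSign (σ i) * t i k) := by
  induction n with
  | zero => intro A t; simp
  | succ n ih =>
    intro A t
    rw [sum_signs_succ, sum_signs_succ]
    simp only [Fin.sum_univ_succ, Fin.cons_zero, Fin.cons_succ, rademacherSign_true,
      rademacherSign_false, one_mul, neg_mul, Finset.sum_add_distrib, ← add_assoc, ← sub_eq_add_neg]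
    refine (add_le_add (ih (fun k => A k + φ (t 0 k)) fun i => t i.succ)
      (ih (fun k => A k - φ (t 0 k)) fun i => t i.succ)).trans ?_
    rw [← Finset.sum_add_distrib, ← Finset.sum_add_distrib]
    refine Finset.sum_le_sum fun σ _ => ?_
    have := ciSup_add_ciSup_contraction
      (fun k => A k + ∑ i : Fin n, rademacherSign (σ i) * t i.succ k) (t 0) hφ
    convert this using 4 <;> first | rfl | ring

/-- **Talagrand's contraction lemma** for a finite class. -/
theorem rademacherAverage_contraction [Nonempty ι] {φ : ℝ → ℝ}
    (hφ : ∀ a b, |φ a - φ b| ≤ |a - b|) {n : ℕ}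
    (t : Fin n → ι → ℝ) :
    rademacherAverage (fun i k => φ (t i k)) ≤ rademacherAverage t := by
  unfold rademacherAverage
  refine div_le_div_of_nonneg_right ?_ (by positivity)
  simpa using sum_ciSup_contraction hφ n 0 t

theorem abs_rademacherAverage_sub_le [Nonempty ι] {n : ℕ} {t t' : Fin n → ι → ℝ} {c : ℝ}
    (h : ∀ k, ∑ i, |t i k - t' i k| ≤ c) :
    |rademacherAverage t - rademacherAverage t'| ≤ c := by
  unfold rademacherAverage
  rw [← sub_div, ← Finset.sum_sub_distrib, abs_div, abs_of_pos (by positivity : (0 : ℝ) < 2 ^ n),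
    div_le_iff₀ (by positivity)]
  refine (Finset.abs_sum_le_sum_abs _ _).trans ((Finset.sum_le_card_nsmul _ _ c fun σ _ => ?_).trans
    (by simp [mul_comm]))
  refine abs_ciSup_sub_ciSup_le fun k => ?_
  rw [← Finset.sum_sub_distrib]
  refine (Finset.abs_sum_le_sum_abs _ _).trans ((Finset.sum_le_sum fun i _ => ?_).trans (h k))
  rw [← mul_sub, abs_mul, abs_rademacherSign, one_mul]

variable {Z : Type*} [MeasurableSpace Z]

theorem measurable_rademacherAverage {n : ℕ} {g : ι → Z → ℝ} (hg : ∀ k, Measurable (g k)) :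
    Measurable fun S : Fin n → Z => rademacherAverage fun i k => g k (S i) := by
  unfold rademacherAverage
  refine (Finset.measurable_fun_sum _ fun σ _ => Measurable.iSup fun k => ?_).div_const _
  fun_prop

/-- **Symmetrization**: the expected uniform deviation is at most twice the expected Rademacher
average. -/
theorem integral_ciSup_deviation_le [Nonempty ι] (μ : Measure Z) [IsProbabilityMeasure μ] {n : ℕ}
    {g : ι → Z → ℝ} (hg : ∀ k, Measurable (g k)) (hg₁ : ∀ k z, |g k z| ≤ 1) :
    ∫ S : Fin n → Z, ⨆ k, (n * (∫ z, g k z ∂μ) - ∑ i, g k (S i)) ∂Measure.pi (fun _ => μ) ≤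
      2 * ∫ S : Fin n → Z, rademacherAverage (fun i k => g k (S i)) ∂Measure.pi (fun _ => μ) := by
  set ν := Measure.pi fun _ : Fin n => μ with hν
  set G : (Fin n → Z) × (Fin n → Z) → ℝ := fun q => ⨆ k, ∑ i, (g k (q.2 i) - g k (q.1 i)) with hG
  have hGm : Measurable G := Measurable.iSup fun k => by fun_prop
  have hGb : ∀ q, |G q| ≤ n * 2 := fun q => abs_ciSup_le_of_finite fun k =>
    (Finset.abs_sum_le_sum_abs _ _).trans ((Finset.sum_le_card_nsmul _ _ 2 fun i _ => by
      exact (abs_sub _ _).trans (by linarith [hg₁ k (q.2 i), hg₁ k (q.1 i)])).trans (by simp))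
  have hGi : Integrable G (ν.prod ν) :=
    Integrable.of_bound hGm.aestronglyMeasurable _ (Filter.Eventually.of_forall hGb)
  have hGS : ∀ S, Integrable (fun S' => G (S, S')) ν := fun S =>
    Integrable.of_bound (hGm.comp measurable_prodMk_left).aestronglyMeasurable _
      (Filter.Eventually.of_forall fun S' => hGb (S, S'))
  have hgk : ∀ k i, Integrable (fun S : Fin n → Z => g k (S i)) ν := fun k i =>
    Integrable.of_bound ((hg k).comp (measurable_pi_apply i)).aestronglyMeasurable 1
      (Filter.Eventually.of_forall fun S => hg₁ _ _)
  -- Each mean is written as an average over an independent ghost sample `S'`; a supremum of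
  -- averages is at most the average of the supremum.
  have hstep : ∀ S : Fin n → Z, ⨆ k, (n * (∫ z, g k z ∂μ) - ∑ i, g k (S i)) ≤
      ∫ S', G (S, S') ∂ν := fun S => by
    refine ciSup_le fun k => ?_
    have : n * (∫ z, g k z ∂μ) - ∑ i, g k (S i) =
        ∫ S', ∑ i, (g k (S' i) - g k (S i)) ∂ν := by
      rw [integral_finsetSum (f := fun i (S' : Fin n → Z) => g k (S' i) - g k (S i)) _
        fun i _ => (hgk k i).sub (integrable_const _)]
      simp_rw [integral_sub (hgk k _) (integrable_const _)]
      have h : ∀ i, ∫ S' : Fin n → Z, g k (S' i) ∂ν = ∫ z, g k z ∂μ := fun i =>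
        integral_comp_eval (μ := fun _ : Fin n => μ) (hg k).aestronglyMeasurable
      simp [h]
    rw [this]
    exact integral_mono (integrable_finsetSum _ fun i _ => (hgk k i).sub (integrable_const _))
      (hGS S) fun S' => le_ciSup_of_finite (fun k => ∑ i, (g k (S' i) - g k (S i))) k
  set P := Measure.pi fun _ : Fin n => μ.prod μ with hP
  have hpres : MeasurePreserving (fun ω : Fin n → Z × Z => (fun i => (ω i).1, fun i => (ω i).2))
      P (ν.prod ν) := measurePreserving_arrowProdEquivProdArrow Z Z (Fin n) _ _
  have hfst : MeasurePreserving (fun (ω : Fin n → Z × Z) i => (ω i).1) P ν :=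
    measurePreserving_pi _ _ fun _ => measurePreserving_fst
  have hsnd : MeasurePreserving (fun (ω : Fin n → Z × Z) i => (ω i).2) P ν :=
    measurePreserving_pi _ _ fun _ => measurePreserving_snd
  set R : (Fin n → Bool) → (Fin n → Z) → ℝ := fun σ S => ⨆ k, ∑ i, rademacherSign (σ i) * g k (S i)
    with hR
  have hRm : ∀ σ, Measurable (R σ) := fun σ => Measurable.iSup fun k => by fun_prop
  have hRi : ∀ σ, Integrable (R σ) ν := fun σ => by
    refine Integrable.of_bound (hRm σ).aestronglyMeasurable n (Filter.Eventually.of_forall fun S =>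
      abs_ciSup_le_of_finite fun k => (Finset.abs_sum_le_sum_abs _ _).trans
        ((Finset.sum_le_card_nsmul _ _ 1 fun i _ => ?_).trans (by simp)))
    rw [abs_mul, abs_rademacherSign, one_mul]
    exact hg₁ _ _
  have hsym : ∀ σ : Fin n → Bool,
      ∫ q, G q ∂ν.prod ν ≤ ∫ S, R σ S ∂ν + ∫ S, R (fun i => !σ i) S ∂ν := by
    intro σ
    -- Exchanging a sample point with its ghost wherever the sign is negative preserves the joint
    -- law and multiplies the `i`-th difference by that sign.
    have hsw : MeasurePreserving (fun (ω : Fin n → Z × Z) i => if σ i then ω i else (ω i).swap)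
        P P := by
      refine measurePreserving_pi (fun _ => μ.prod μ) (fun _ => μ.prod μ)
        (f := fun i (q : Z × Z) => if σ i then q else q.swap) fun i => ?_
      cases σ i
      · exact Measure.measurePreserving_swap
      · exact MeasurePreserving.id _
    have e₁ : ∫ q, G q ∂ν.prod ν = ∫ ω, G (fun i => (ω i).1, fun i => (ω i).2) ∂P := by
      rw [← hpres.map_eq, integral_map hpres.measurable.aemeasurable hGm.aestronglyMeasurable]
    have hG'm : Measurable fun ω : Fin n → Z × Z => G (fun i => (ω i).1, fun i => (ω i).2) :=
      hGm.comp hpres.measurable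
    have e₂ : ∫ ω, G (fun i => (ω i).1, fun i => (ω i).2) ∂P =
        ∫ ω, ⨆ k, ∑ i, rademacherSign (σ i) * (g k (ω i).2 - g k (ω i).1) ∂P := by
      conv_lhs => rw [← hsw.map_eq]
      rw [integral_map hsw.measurable.aemeasurable hG'm.aestronglyMeasurable]
      refine integral_congr_ae (Filter.Eventually.of_forall fun ω => ?_)
      simp only [hG]
      congr! 3 with k i
      cases h : σ i <;> simp [rademacherSign]
    have e₃ : ∫ S, R σ S ∂ν = ∫ ω, R σ (fun i => (ω i).2) ∂P := by
      rw [← hsnd.map_eq, integral_map hsnd.measurable.aemeasurable (hRm σ).aestronglyMeasurable]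
    have e₄ : ∫ S, R (fun i => !σ i) S ∂ν = ∫ ω, R (fun i => !σ i) (fun i => (ω i).1) ∂P := by
      rw [← hfst.map_eq, integral_map hfst.measurable.aemeasurable (hRm _).aestronglyMeasurable]
    have i₃ : Integrable (fun ω => R σ fun i => (ω i).2) P :=
      hsnd.integrable_comp_of_integrable (hRi σ)
    have i₄ : Integrable (fun ω => R (fun i => !σ i) fun i => (ω i).1) P :=
      hfst.integrable_comp_of_integrable (hRi fun i => !σ i)
    rw [e₁, e₂, e₃, e₄, ← integral_add i₃ i₄]
    have hmeas : Measurable fun ω : Fin n → Z × Z =>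
        ⨆ k, ∑ i, rademacherSign (σ i) * (g k (ω i).2 - g k (ω i).1) :=
      Measurable.iSup fun k => by fun_prop
    refine integral_mono (Integrable.of_bound hmeas.aestronglyMeasurable (n * 2)
      (Filter.Eventually.of_forall fun ω => abs_ciSup_le_of_finite fun k =>
        (Finset.abs_sum_le_sum_abs _ _).trans ((Finset.sum_le_card_nsmul _ _ 2 fun i _ => ?_).trans
          (by simp)))) (i₃.add i₄) fun ω => ciSup_le fun k => ?_
    · rw [abs_mul, abs_rademacherSign, one_mul]
      exact (abs_sub _ _).trans (by linarith [hg₁ k (ω i).2, hg₁ k (ω i).1])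
    · have h₁ := le_ciSup_of_finite (fun k => ∑ i, rademacherSign (σ i) * g k (ω i).2) k
      have h₂ := le_ciSup_of_finite (fun k => ∑ i, rademacherSign (!σ i) * g k (ω i).1) k
      refine le_trans (le_of_eq ?_) (add_le_add h₁ h₂)
      rw [← Finset.sum_add_distrib]
      refine Finset.sum_congr rfl fun i _ => ?_
      rw [rademacherSign_not]; ring
  -- Flipping all signs permutes the sign vectors, so both halves have the same total; this is the
  -- factor 2.
  have hnot : ∑ σ : Fin n → Bool, ∫ S, R (fun i => !σ i) S ∂ν = ∑ σ, ∫ S, R σ S ∂ν :=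
    Fintype.sum_equiv (Equiv.piCongrRight fun _ => Equiv.boolNot) _ _ fun σ => rfl
  have havg : ∫ S : Fin n → Z, rademacherAverage (fun i k => g k (S i)) ∂ν =
      (∑ σ, ∫ S, R σ S ∂ν) / 2 ^ n := by
    unfold rademacherAverage
    rw [integral_div, integral_finsetSum _ fun σ _ => hRi σ]
  have hsum := Finset.sum_le_sum fun (σ : Fin n → Bool) (_ : σ ∈ Finset.univ) => hsym σ
  rw [Finset.sum_add_distrib, hnot] at hsum
  simp only [Finset.sum_const, Finset.card_univ, Fintype.card_pi, Fintype.card_bool,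
    Finset.prod_const, Fintype.card_fin, nsmul_eq_mul, Nat.cast_pow, Nat.cast_ofNat] at hsum
  calc ∫ S : Fin n → Z, ⨆ k, (n * (∫ z, g k z ∂μ) - ∑ i, g k (S i)) ∂ν
      ≤ ∫ S, ∫ S', G (S, S') ∂ν ∂ν := by
        refine integral_mono (Integrable.of_bound (Measurable.iSup fun k => by
          fun_prop).aestronglyMeasurable (n * 2) (Filter.Eventually.of_forall fun S =>
            abs_ciSup_le_of_finite fun k => ?_)) hGi.integral_prod_left hstep
        have h₁ : |∫ z, g k z ∂μ| ≤ 1 := by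
          simpa using norm_integral_le_of_norm_le_const (μ := μ) (f := g k) (C := 1)
            (Filter.Eventually.of_forall fun z => hg₁ _ _)
        have h₂ : |∑ i, g k (S i)| ≤ n := (Finset.abs_sum_le_sum_abs _ _).trans
          ((Finset.sum_le_card_nsmul _ _ 1 fun i _ => hg₁ _ _).trans (by simp))
        refine (abs_sub _ _).trans ?_
        rw [abs_mul, Nat.abs_cast]
        nlinarith [(Nat.cast_nonneg n : (0 : ℝ) ≤ n)]
    _ = ∫ q, G q ∂ν.prod ν := (integral_prod G hGi).symm
    _ ≤ _ := by
        rw [havg, ← mul_div_assoc, le_div_iff₀ (by positivity)]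
        linarith

end Finite

/-! ### Uniform deviation: finite, countable and separable classes -/

/-- The uniform deviation bound for a finite class of `[0, 1]`-valued functions in terms of the
empirical Rademacher average. -/
theorem measure_exists_deviation_le {ι Z : Type*} [Finite ι] [Nonempty ι] [MeasurableSpace Z]
    (μ : Measure Z) [IsProbabilityMeasure μ] {n : ℕ} (hn : 0 < n) {g : ι → Z → ℝ}
    (hg : ∀ k, Measurable (g k)) (hg₀ : ∀ k z, 0 ≤ g k z) (hg₁ : ∀ k z, g k z ≤ 1) {s : ℝ}
    (hs : 0 ≤ s) :
    (Measure.pi fun _ : Fin n => μ).real {S | ∃ k, ∑ i, g k (S i) +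
        2 * rademacherAverage (fun i k => g k (S i)) + s < n * ∫ z, g k z ∂μ} ≤
      Real.exp (-(2 * s ^ 2 / (n * 3 ^ 2))) := by
  have hg' : ∀ k z, |g k z| ≤ 1 := fun k z => by
    rw [abs_of_nonneg (hg₀ k z)]; exact hg₁ k z
  set Φ : (Fin n → Z) → ℝ := fun S => ⨆ k, (n * (∫ z, g k z ∂μ) - ∑ i, g k (S i)) with hΦ
  set A : (Fin n → Z) → ℝ := fun S => rademacherAverage fun i k => g k (S i) with hA
  have hΦm : Measurable Φ := Measurable.iSup fun k => by fun_prop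
  have hAm : Measurable A := measurable_rademacherAverage hg
  have hΦb : ∀ S, |Φ S| ≤ n * 2 := fun S => abs_ciSup_le_of_finite fun k => by
    have h₁ : |∫ z, g k z ∂μ| ≤ 1 := by
      simpa using norm_integral_le_of_norm_le_const (μ := μ) (f := g k) (C := 1)
        (Filter.Eventually.of_forall fun z => hg' _ _)
    have h₂ : |∑ i, g k (S i)| ≤ n := (Finset.abs_sum_le_sum_abs _ _).trans
      ((Finset.sum_le_card_nsmul _ _ 1 fun i _ => hg' _ _).trans (by simp))
    refine (abs_sub _ _).trans ?_
    rw [abs_mul, Nat.abs_cast]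
    nlinarith [(Nat.cast_nonneg n : (0 : ℝ) ≤ n)]
  have hAb : ∀ S, |A S| ≤ n := fun S => by
    have h := abs_rademacherAverage_sub_le (t := fun i k => g k (S i))
      (t' := fun (_ : Fin n) (_ : ι) => 0) (c := n) fun k =>
        (Finset.sum_le_card_nsmul _ _ 1 fun i _ => by simpa using hg' _ _).trans (by simp)
    simpa [hA, rademacherAverage] using h
  have hdist : ∀ (S : Fin n → Z) i z k, ∑ j, |g k (Function.update S i z j) - g k (S j)| ≤ 1 :=
    fun S i z k => by
      rw [Finset.sum_eq_single i (fun j _ hj => by simp [Function.update_of_ne hj]) (by simp),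
        Function.update_self, abs_le]
      constructor <;> linarith [hg₀ k z, hg₁ k z, hg₀ k (S i), hg₁ k (S i)]
  -- Replacing one example moves both `Φ` and `A` by at most 1, so `Φ - 2 * A` moves by at most 3:
  -- the source of the constant 3 in the bound. Using this one statistic avoids a union bound.
  have hFd : ∀ S i z, |(Φ (Function.update S i z) - 2 * A (Function.update S i z)) -
      (Φ S - 2 * A S)| ≤ 3 := fun S i z => by
    have h₁ : |Φ (Function.update S i z) - Φ S| ≤ 1 := abs_ciSup_sub_ciSup_le fun k => by
      rw [sub_sub_sub_cancel_left, ← Finset.sum_sub_distrib, ← abs_neg, ← Finset.sum_neg_distrib]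
      simp only [neg_sub]
      exact (Finset.abs_sum_le_sum_abs _ _).trans (hdist S i z k)
    have h₂ : |A (Function.update S i z) - A S| ≤ 1 := abs_rademacherAverage_sub_le (hdist S i z)
    rw [abs_le] at *
    constructor <;> linarith [h₁.1, h₁.2, h₂.1, h₂.2]
  have hmean : ∫ S, (Φ S - 2 * A S) ∂Measure.pi (fun _ => μ) ≤ 0 := by
    rw [integral_sub (Integrable.of_bound hΦm.aestronglyMeasurable _
      (Filter.Eventually.of_forall hΦb)) ((Integrable.of_bound hAm.aestronglyMeasurable _
      (Filter.Eventually.of_forall hAb)).const_mul 2), integral_const_mul]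
    linarith [integral_ciSup_deviation_le μ (n := n) hg hg']
  refine (measureReal_mono ?_).trans (measure_ge_le_of_bounded_differences μ (c := 3)
    (C := n * 2 + 2 * n) (by norm_num) hn (fun S => Φ S - 2 * A S) (by fun_prop) (fun S => ?_)
    hFd hs)
  · rintro S ⟨k, hk⟩
    have := le_ciSup_of_finite (fun k => n * (∫ z, g k z ∂μ) - ∑ i, g k (S i)) k
    simp only [Set.mem_ofPred_eq]
    have h' : n * (∫ z, g k z ∂μ) - ∑ i, g k (S i) ≤ Φ S := this
    linarith
  · refine (abs_sub _ _).trans ?_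
    rw [abs_mul, abs_two]
    linarith [hΦb S, hAb S]

/-- The uniform deviation bound for a countable class of `[0, 1]`-valued functions whose finite
subclasses have empirical Rademacher average at most `R`. -/
theorem le_measure_forall_deviation {Z : Type*} [MeasurableSpace Z]
    (μ : Measure Z) [IsProbabilityMeasure μ] {n : ℕ} (hn : 0 < n) {g : ℕ → Z → ℝ}
    (hg : ∀ k, Measurable (g k)) (hg₀ : ∀ k z, 0 ≤ g k z) (hg₁ : ∀ k z, g k z ≤ 1)
    {R : (Fin n → Z) → ℝ} (hRm : Measurable R)
    (hR : ∀ N S, rademacherAverage (fun i (k : Fin (N + 1)) => g k (S i)) ≤ R S) {s : ℝ}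
    (hs : 0 ≤ s) :
    MeasurableSet {S : Fin n → Z | ∀ k, n * ∫ z, g k z ∂μ ≤ ∑ i, g k (S i) + 2 * R S + s} ∧
    ENNReal.ofReal (1 - Real.exp (-(2 * s ^ 2 / (n * 3 ^ 2)))) ≤
      Measure.pi (fun _ : Fin n => μ)
        {S | ∀ k, n * ∫ z, g k z ∂μ ≤ ∑ i, g k (S i) + 2 * R S + s} := by
  set ν := Measure.pi fun _ : Fin n => μ
  set E := {S : Fin n → Z | ∀ k, n * ∫ z, g k z ∂μ ≤ ∑ i, g k (S i) + 2 * R S + s} with hE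
  have hEm : MeasurableSet E := by
    rw [hE, Set.ofPred_forall]
    exact MeasurableSet.iInter fun k => measurableSet_le (by fun_prop) (by fun_prop)
  refine ⟨hEm, ?_⟩
  set B : ℕ → Set (Fin n → Z) := fun N =>
    {S | ∃ k : Fin (N + 1), ∑ i, g k (S i) + 2 * R S + s < n * ∫ z, g k z ∂μ} with hB
  -- The bad events of the first `N + 1` functions increase to the complement of `E`, and their
  -- probability bound does not depend on `N`.
  have hBmono : Monotone B := fun N N' h S ⟨k, hk⟩ => ⟨Fin.castLE (by lia) k, by simpa using hk⟩
  have hcompl : Eᶜ = ⋃ N, B N := by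
    ext S
    simp only [hE, hB, Set.mem_compl_iff, Set.mem_ofPred_eq, not_forall, not_le, Set.mem_iUnion]
    exact ⟨fun ⟨k, hk⟩ => ⟨k, Fin.last k, by simpa using hk⟩, fun ⟨N, k, hk⟩ => ⟨k, hk⟩⟩
  have hle : ν Eᶜ ≤ ENNReal.ofReal (Real.exp (-(2 * s ^ 2 / (n * 3 ^ 2)))) := by
    rw [hcompl, hBmono.measure_iUnion]
    refine iSup_le fun N => ?_
    rw [← ofReal_measureReal]
    refine ENNReal.ofReal_le_ofReal ((measureReal_mono ?_).trans
      (measure_exists_deviation_le μ hn (g := fun k : Fin (N + 1) => g k) (fun k => hg k)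
        (fun k => hg₀ k) (fun k => hg₁ k) hs))
    rintro S ⟨k, hk⟩
    exact ⟨k, by linarith [hR N S]⟩
  rw [ENNReal.ofReal_sub _ (Real.exp_pos _).le, ENNReal.ofReal_one, tsub_le_iff_right]
  calc 1 = ν (E ∪ Eᶜ) := by rw [Set.union_compl_self, measure_univ]
    _ ≤ ν E + ν Eᶜ := measure_union_le _ _
    _ ≤ _ := by gcongr

/-- The uniform deviation bound for a `[0, 1]`-valued Lipschitz loss over a separable class of
functions depending continuously on a parameter. -/
theorem exists_measurableSet_forall_deviation {Z Θ : Type*} [MeasurableSpace Z]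
    [TopologicalSpace Θ] [TopologicalSpace.SeparableSpace Θ] [FirstCountableTopology Θ] [Nonempty Θ]
    (μ : Measure Z) [IsProbabilityMeasure μ] {n : ℕ} (hn : 0 < n) {f : Θ → Z → ℝ}
    (hf : ∀ θ, Measurable (f θ)) (hfc : ∀ z, Continuous fun θ => f θ z) {φ : ℝ → ℝ}
    (hφ : ∀ a b, |φ a - φ b| ≤ |a - b|) (hφ₀ : ∀ a, 0 ≤ φ a) (hφ₁ : ∀ a, φ a ≤ 1)
    {R : (Fin n → Z) → ℝ} (hRm : Measurable R)
    (hR : ∀ N (u : Fin (N + 1) → Θ) S, rademacherAverage (fun i k => f (u k) (S i)) ≤ R S)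
    {δ : ℝ} (hδ : 0 < δ) (hδ₁ : δ ≤ 1) :
    ∃ E : Set (Fin n → Z), MeasurableSet E ∧
      ENNReal.ofReal (1 - δ) ≤ Measure.pi (fun _ : Fin n => μ) E ∧
      ∀ S ∈ E, ∀ θ, n * ∫ z, φ (f θ z) ∂μ ≤
        ∑ i, φ (f θ (S i)) + 2 * R S + 3 * √(n * Real.log (1 / δ) / 2) := by
  have hφc : Continuous φ := by
    refine LipschitzWith.continuous (K := 1) (LipschitzWith.of_dist_le_mul fun a b => ?_)
    simpa [Real.dist_eq] using hφ a b
  have hlog : 0 ≤ Real.log (1 / δ) := Real.log_nonneg (by rw [le_div_iff₀ hδ]; linarith)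
  obtain ⟨hEm, hE⟩ := le_measure_forall_deviation μ hn
    (g := fun k z => φ (f (TopologicalSpace.denseSeq Θ k) z))
    (fun k => hφc.measurable.comp (hf _)) (fun _ _ => hφ₀ _) (fun _ _ => hφ₁ _) hRm
    (fun N S => (rademacherAverage_contraction hφ
      (fun i (k : Fin (N + 1)) => f (TopologicalSpace.denseSeq Θ k) (S i))).trans (hR N _ S))
    (s := 3 * √(n * Real.log (1 / δ) / 2)) (by positivity)
  refine ⟨_, hEm, le_of_eq_of_le ?_ hE, fun S hS θ => ?_⟩
  · have hn' : (n : ℝ) ≠ 0 := by exact_mod_cast hn.ne'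
    rw [mul_pow, Real.sq_sqrt (by positivity)]
    have : 2 * (3 ^ 2 * (n * Real.log (1 / δ) / 2)) / (n * 3 ^ 2) = Real.log (1 / δ) := by
      field_simp
    rw [this, Real.log_div one_ne_zero hδ.ne', Real.log_one, zero_sub, neg_neg, Real.exp_log hδ]
  -- On `E` the inequality holds along a dense sequence; both sides are continuous in `θ`, the risk
  -- by dominated convergence, so it holds everywhere.
  · have hrisk : Continuous fun θ => ∫ z, φ (f θ z) ∂μ :=
      continuous_of_dominated (bound := fun _ => 1)
        (fun θ => (hφc.measurable.comp (hf θ)).aestronglyMeasurable)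
        (fun θ => Filter.Eventually.of_forall fun z => by
          rw [Real.norm_of_nonneg (hφ₀ _)]; exact hφ₁ _) (integrable_const _)
        (Filter.Eventually.of_forall fun z => hφc.comp (hfc z))
    refine (TopologicalSpace.denseRange_denseSeq Θ).induction_on
      (p := fun θ => n * ∫ z, φ (f θ z) ∂μ ≤
        ∑ i, φ (f θ (S i)) + 2 * R S + 3 * √(n * Real.log (1 / δ) / 2)) θ ?_ hS
    refine isClosed_le (continuous_const.mul hrisk) (.add (.add ?_ continuous_const)
      continuous_const)
    exact continuous_finsetSum _ fun i _ => hφc.comp (hfc (S i))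

/-! ### Moments and maxima of Rademacher sums -/

/-- Independent signs are orthogonal: the cross terms cancel when the two values of each sign are
added. -/
theorem sum_signs_sq {n : ℕ} (a : Fin n → ℝ) :
    ∑ σ : Fin n → Bool, (∑ i, rademacherSign (σ i) * a i) ^ 2 = 2 ^ n * ∑ i, a i ^ 2 := by
  induction n with
  | zero => simp
  | succ n ih =>
    rw [sum_signs_succ]
    simp only [Fin.sum_univ_succ, Fin.cons_zero, Fin.cons_succ, rademacherSign_true,
      rademacherSign_false, one_mul, neg_mul]
    have : ∀ T : ℝ, (a 0 + T) ^ 2 + (-a 0 + T) ^ 2 = 2 * a 0 ^ 2 + 2 * T ^ 2 := fun T => by ring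
    simp only [this, Finset.sum_add_distrib, ← Finset.mul_sum, ih fun i => a i.succ]
    simp
    ring

/-- Each sign contributes a factor `2 * cosh (a i)`, and `cosh x ≤ exp (x ^ 2 / 2)`. -/
theorem sum_signs_exp_le {n : ℕ} (a : Fin n → ℝ) :
    ∑ σ : Fin n → Bool, Real.exp (∑ i, rademacherSign (σ i) * a i) ≤
      2 ^ n * Real.exp ((∑ i, a i ^ 2) / 2) := by
  induction n with
  | zero => simp
  | succ n ih =>
    rw [sum_signs_succ]
    simp only [Fin.sum_univ_succ, Fin.cons_zero, Fin.cons_succ, rademacherSign_true,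
      rademacherSign_false, one_mul, neg_mul]
    have : ∀ T : ℝ, Real.exp (a 0 + T) + Real.exp (-a 0 + T) =
        2 * Real.cosh (a 0) * Real.exp T := fun T => by
      rw [Real.exp_add, Real.exp_add, Real.cosh_eq]; ring
    simp only [this, ← Finset.mul_sum]
    calc _ ≤ 2 * Real.exp (a 0 ^ 2 / 2) * (2 ^ n * Real.exp ((∑ i : Fin n, a i.succ ^ 2) / 2)) := by
          gcongr
          · exact Real.cosh_le_exp_half_sq _
          · exact ih fun i => a i.succ
      _ = _ := by rw [add_div, Real.exp_add]; ring

/-- Jensen's inequality for the square of an average over signs. -/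
theorem sum_signs_div_le_sqrt {n : ℕ} (B : (Fin n → Bool) → ℝ) :
    (∑ σ, B σ) / 2 ^ n ≤ √((∑ σ, B σ ^ 2) / 2 ^ n) := by
  refine Real.le_sqrt_of_sq_le ?_
  have := sq_sum_le_card_mul_sum_sq (s := Finset.univ) (f := B)
  simp only [Finset.card_univ, Fintype.card_pi, Fintype.card_bool, Finset.prod_const,
    Fintype.card_fin, Nat.cast_pow, Nat.cast_ofNat] at this
  rw [div_pow, div_le_div_iff₀ (by positivity) (by positivity)]
  have h2 : (0 : ℝ) < 2 ^ n := by positivity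
  nlinarith

theorem sum_signs_abs_le (n : ℕ) :
    (∑ σ : Fin n → Bool, |∑ i, rademacherSign (σ i)|) / 2 ^ n ≤ √(n : ℝ) := by
  refine (sum_signs_div_le_sqrt _).trans (Real.sqrt_le_sqrt (le_of_eq ?_))
  have := sum_signs_sq fun _ : Fin n => 1
  simp only [mul_one, one_pow] at this
  simp only [sq_abs, this]
  simp

theorem sum_signs_norm_two_le {n d : ℕ} (a : Fin n → Fin d → ℝ) {X : ℝ} (hX : 0 ≤ X)
    (ha : ∀ i, ∑ j, a i j ^ 2 ≤ X ^ 2) :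
    (∑ σ : Fin n → Bool, √(∑ j, (∑ i, rademacherSign (σ i) * a i j) ^ 2)) / 2 ^ n ≤
      √(n : ℝ) * X := by
  refine (sum_signs_div_le_sqrt _).trans ?_
  rw [← Real.sqrt_sq hX, ← Real.sqrt_mul (by positivity)]
  refine Real.sqrt_le_sqrt ?_
  have hsq : ∀ σ : Fin n → Bool, √(∑ j, (∑ i, rademacherSign (σ i) * a i j) ^ 2) ^ 2 =
      ∑ j, (∑ i, rademacherSign (σ i) * a i j) ^ 2 := fun σ =>
    Real.sq_sqrt (Finset.sum_nonneg fun j _ => sq_nonneg _)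
  simp only [hsq]
  rw [Finset.sum_comm, Finset.sum_congr rfl fun j _ => sum_signs_sq fun i => a i j,
    ← Finset.mul_sum, mul_div_cancel_left₀ _ (by positivity), Finset.sum_comm]
  exact (Finset.sum_le_card_nsmul _ _ _ fun i _ => ha i).trans (by simp)

/-- **Massart's lemma** for the coordinates of a vector-valued Rademacher sum. -/
theorem sum_signs_max_le {n d : ℕ} (hn : 0 < n) (a : Fin n → Fin d → ℝ) {X : ℝ} (hX : 0 ≤ X)
    (ha : ∀ i j, |a i j| ≤ X) (b : (Fin n → Bool) → Fin d) :
    (∑ σ : Fin n → Bool, |∑ i, rademacherSign (σ i) * a i (b σ)|) / 2 ^ n ≤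
      √(n : ℝ) * X * √(2 * Real.log (2 * d)) := by
  -- The parameter `l` below divides by `X`, so `X = 0` is treated apart.
  rcases hX.eq_or_lt with rfl | hX
  · have : ∀ i j, a i j = 0 := fun i j => abs_nonpos_iff.1 (ha i j)
    simp [this]
  have hd : 0 < d := (b default).pos
  have hd' : (1 : ℝ) ≤ d := by exact_mod_cast hd
  have hn' : (0 : ℝ) < n := by exact_mod_cast hn
  set L := Real.log (2 * d) with hL
  have hLpos : 0 < L := Real.log_pos (by linarith)
  -- Chosen so that `n * (l * X) ^ 2 / 2 = L`, balancing the two terms of `log K`. The factor `2 *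
  -- d` in `K` counts the coordinates with both signs.
  set l : ℝ := √(2 * L) / (√(n : ℝ) * X) with hl
  have hlpos : 0 < l := by positivity
  set K : ℝ := 2 * d * Real.exp (n * (l * X) ^ 2 / 2) with hK
  have hKpos : 0 < K := by positivity
  set M : (Fin n → Bool) → ℝ := fun σ => |∑ i, rademacherSign (σ i) * a i (b σ)|
  have hexp : ∑ σ, Real.exp (l * M σ) ≤ 2 ^ n * K := by
    have hpt : ∀ σ, Real.exp (l * M σ) ≤ ∑ j, (Real.exp (∑ i, rademacherSign (σ i) * (l * a i j)) +
        Real.exp (∑ i, rademacherSign (σ i) * (-l * a i j))) := fun σ => by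
      refine le_trans ?_ (Finset.single_le_sum (f := fun j =>
        Real.exp (∑ i, rademacherSign (σ i) * (l * a i j)) +
        Real.exp (∑ i, rademacherSign (σ i) * (-l * a i j))) (fun j _ => by positivity)
        (Finset.mem_univ (b σ)))
      simp only [mul_left_comm (rademacherSign _), ← Finset.mul_sum, M]
      rcases abs_cases (∑ i, rademacherSign (σ i) * a i (b σ)) with ⟨h, _⟩ | ⟨h, _⟩ <;> rw [h]
      · exact le_add_of_nonneg_right (Real.exp_pos _).le
      · rw [mul_neg, ← neg_mul]
        exact le_add_of_nonneg_left (Real.exp_pos _).le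
    have hj : ∀ (c : ℝ) j, |c| = l → ∑ σ : Fin n → Bool,
        Real.exp (∑ i, rademacherSign (σ i) * (c * a i j)) ≤
          2 ^ n * Real.exp (n * (l * X) ^ 2 / 2) := fun c j hc => by
      refine (sum_signs_exp_le _).trans ?_
      gcongr
      refine (Finset.sum_le_card_nsmul _ _ ((l * X) ^ 2) fun i _ => ?_).trans (by simp)
      rw [← sq_abs, abs_mul, hc]
      gcongr
      exact ha i j
    refine (Finset.sum_le_sum fun σ _ => hpt σ).trans ?_
    rw [Finset.sum_comm]
    refine (Finset.sum_le_card_nsmul _ _ (2 * (2 ^ n * Real.exp (n * (l * X) ^ 2 / 2)))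
      fun j _ => ?_).trans (le_of_eq ?_)
    · rw [Finset.sum_add_distrib, two_mul]
      exact add_le_add (hj l j (abs_of_pos hlpos)) (hj (-l) j (by rw [abs_neg, abs_of_pos hlpos]))
    · simp [hK]; ring
  -- The tangent inequality `log u ≤ u - 1` at `u = exp (l * M σ) / K` plays the part of Jensen's
  -- inequality: averaged over `σ` it bounds `l` times the mean of `M` by `log K`.
  have hlin : ∀ σ, l * M σ ≤ Real.log K + (Real.exp (l * M σ) / K - 1) := fun σ => by
    have := Real.log_le_sub_one_of_pos (x := Real.exp (l * M σ) / K) (by positivity)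
    rw [Real.log_div (Real.exp_pos _).ne' hKpos.ne', Real.log_exp] at this
    linarith
  have hsum := Finset.sum_le_sum fun σ (_ : σ ∈ Finset.univ) => hlin σ
  rw [← Finset.mul_sum, Finset.sum_add_distrib, Finset.sum_sub_distrib, ← Finset.sum_div] at hsum
  simp only [Finset.sum_const, Finset.card_univ, Fintype.card_pi, Fintype.card_bool,
    Finset.prod_const, Fintype.card_fin, nsmul_eq_mul, Nat.cast_pow, Nat.cast_ofNat,
    mul_one] at hsum
  have hdiv : (∑ σ, Real.exp (l * M σ)) / K ≤ 2 ^ n := by rwa [div_le_iff₀ hKpos]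
  have hlogK : Real.log K = L + n * (l * X) ^ 2 / 2 := by
    rw [hK, Real.log_mul (by positivity) (Real.exp_pos _).ne', Real.log_exp]
  have hlX : n * (l * X) ^ 2 = 2 * L := by
    rw [hl, mul_pow, div_pow, mul_pow, Real.sq_sqrt (by positivity), Real.sq_sqrt hn'.le]
    field_simp
  rw [div_le_iff₀ (by positivity)]
  have hmain : l * ∑ σ, M σ ≤ 2 ^ n * (2 * L) := by
    rw [hlogK, hlX] at hsum
    linarith
  have hl' : l * (√(n : ℝ) * X * √(2 * L)) = 2 * L := by
    rw [hl]
    field_simp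
    rw [Real.sq_sqrt (by positivity)]
  refine le_of_mul_le_mul_left ?_ hlpos
  rw [← mul_assoc, hl']
  linarith

/-! ### Comparison of `ℓ_p` norms and Hölder's inequality -/

section EllNorm

variable {d : ℕ}

theorem ellNorm_nonneg {p : ENNReal} (hp : 1 ≤ p) (x : Fin d → ℝ) : 0 ≤ ellNorm p x := by
  have : Fact (1 ≤ p) := ⟨hp⟩
  exact norm_nonneg (WithLp.toLp p x)

theorem ellNorm_zero {p : ENNReal} (hp : 1 ≤ p) : ellNorm p (0 : Fin d → ℝ) = 0 := by
  have : Fact (1 ≤ p) := ⟨hp⟩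
  exact norm_zero (E := PiLp p fun _ : Fin d => ℝ)

theorem ellNorm_neg {p : ENNReal} (hp : 1 ≤ p) (x : Fin d → ℝ) : ellNorm p (-x) = ellNorm p x := by
  have : Fact (1 ≤ p) := ⟨hp⟩
  exact norm_neg (WithLp.toLp p x)

theorem ellNorm_smul {p : ENNReal} (hp : 1 ≤ p) (c : ℝ) (x : Fin d → ℝ) :
    ellNorm p (c • x) = |c| * ellNorm p x := by
  have : Fact (1 ≤ p) := ⟨hp⟩
  exact norm_smul c (WithLp.toLp p x)

theorem abs_le_ellNorm {p : ENNReal} (hp : 1 ≤ p) (x : Fin d → ℝ) (i : Fin d) :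
    |x i| ≤ ellNorm p x := by
  have : Fact (1 ≤ p) := ⟨hp⟩
  exact PiLp.norm_apply_le (WithLp.toLp p x) i

theorem ellNorm_eq_zero {p : ENNReal} (hp : 1 ≤ p) {x : Fin d → ℝ} (h : ellNorm p x = 0) :
    x = 0 := by
  funext i
  exact abs_nonpos_iff.1 (h ▸ abs_le_ellNorm hp x i)

theorem measurable_ellNorm {p : ENNReal} (hp : 1 ≤ p) :
    Measurable (ellNorm p : (Fin d → ℝ) → ℝ) := by
  have : Fact (1 ≤ p) := ⟨hp⟩
  exact (continuous_norm.comp (PiLp.continuous_toLp p fun _ : Fin d => ℝ)).measurable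

theorem ellNorm_one (x : Fin d → ℝ) : ellNorm 1 x = ∑ i, |x i| :=
  PiLp.norm_eq_of_L1 (WithLp.toLp 1 x)

theorem ellNorm_two (x : Fin d → ℝ) : ellNorm 2 x = √(∑ i, x i ^ 2) := by
  simpa [ellNorm] using PiLp.norm_eq_of_L2 (β := fun _ : Fin d => ℝ) (WithLp.toLp 2 x)

theorem ellNorm_eq_sum {p : ENNReal} (hp : 1 ≤ p) (hp' : p ≠ ⊤) (x : Fin d → ℝ) :
    ellNorm p x = (∑ i, |x i| ^ p.toReal) ^ (1 / p.toReal) :=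
  PiLp.norm_eq_sum (ENNReal.toReal_pos (zero_lt_one.trans_le hp).ne' hp') (WithLp.toLp p x)

theorem ellNorm_top_le {x : Fin d → ℝ} {C : ℝ} (hC : 0 ≤ C) (h : ∀ i, |x i| ≤ C) :
    ellNorm ⊤ x ≤ C := by
  change ⨆ i, ‖x i‖ ≤ C
  exact Real.iSup_le h hC

/-- The `ℓ_p` norms decrease with the exponent. -/
theorem ellNorm_anti {r q : ENNReal} (hr : 1 ≤ r) (hrq : r ≤ q) (x : Fin d → ℝ) :
    ellNorm q x ≤ ellNorm r x := by
  have hN := ellNorm_nonneg hr x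
  rcases eq_or_ne q ⊤ with rfl | hq
  · exact ellNorm_top_le hN fun i => abs_le_ellNorm hr x i
  have hr' : r ≠ ⊤ := ne_top_of_le_ne_top hq hrq
  have hr0 : 0 < r.toReal := ENNReal.toReal_pos (zero_lt_one.trans_le hr).ne' hr'
  have hle : r.toReal ≤ q.toReal := ENNReal.toReal_mono hq hrq
  have hq0 : 0 < q.toReal := hr0.trans_le hle
  have hpow : ellNorm r x ^ r.toReal = ∑ i, |x i| ^ r.toReal := by
    rw [ellNorm_eq_sum hr hr', one_div, Real.rpow_inv_rpow (by positivity) hr0.ne']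
  have hsplit : ∀ a : ℝ, 0 ≤ a → a ^ q.toReal = a ^ (q.toReal - r.toReal) * a ^ r.toReal :=
    fun a ha => by
      rw [← Real.rpow_add_of_nonneg ha (by linarith) hr0.le, sub_add_cancel]
  have hsum : ∑ i, |x i| ^ q.toReal ≤ ellNorm r x ^ q.toReal := by
    rw [hsplit _ hN, hpow, Finset.mul_sum]
    refine Finset.sum_le_sum fun i _ => ?_
    rw [hsplit _ (abs_nonneg _)]
    gcongr
    exact abs_le_ellNorm hr x i
  rw [ellNorm_eq_sum (hr.trans hrq) hq]
  calc _ ≤ (ellNorm r x ^ q.toReal) ^ (1 / q.toReal) := by gcongr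
    _ = _ := by rw [one_div, Real.rpow_rpow_inv hN hq0.ne']

/-- For `q ≥ 2` the norms decrease with the exponent; for `q < 2` this is the power mean inequality
with exponent `2 / q`. At `q = ⊤` the convention `1 / 0 = 0` gives the correct exponent 0. -/
theorem ellNorm_le_ellNorm_two_mul {q : ENNReal} (hq : 1 ≤ q) (x : Fin d → ℝ) :
    ellNorm q x ≤ ellNorm 2 x * (d : ℝ) ^ max (1 / q.toReal - 1 / 2) 0 := by
  rcases le_or_gt 2 q with h | h
  · have : max (1 / q.toReal - 1 / 2) 0 = 0 := by
      refine max_eq_right ?_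
      rcases eq_or_ne q ⊤ with rfl | hq'
      · norm_num
      · have : (2 : ℝ) ≤ q.toReal := by simpa using ENNReal.toReal_mono hq' h
        rw [sub_nonpos]
        gcongr
    rw [this, Real.rpow_zero, mul_one]
    exact ellNorm_anti one_le_two h x
  · have hq' : q ≠ ⊤ := h.ne_top
    have hq0 : 0 < q.toReal := ENNReal.toReal_pos (zero_lt_one.trans_le hq).ne' hq'
    have hq2 : q.toReal ≤ 2 := by simpa using ENNReal.toReal_mono (by simp) h.le
    have hle : 1 / 2 ≤ 1 / q.toReal := by gcongr
    rw [max_eq_left (by linarith), ellNorm_eq_sum hq hq', ellNorm_two]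
    have hJ := Real.rpow_sum_le_const_mul_sum_rpow_of_nonneg (s := Finset.univ)
      (f := fun i => |x i| ^ q.toReal) (p := 2 / q.toReal) (by rw [le_div_iff₀ hq0]; linarith)
      fun i _ => by positivity
    have h2 : ∀ i, (|x i| ^ q.toReal) ^ (2 / q.toReal) = x i ^ 2 := fun i => by
      rw [← Real.rpow_mul (abs_nonneg _), mul_div_cancel₀ _ hq0.ne', Real.rpow_two, sq_abs]
    simp only [h2, Finset.card_univ, Fintype.card_fin] at hJ
    have hroot : (∑ i, |x i| ^ q.toReal) ^ (1 / q.toReal) =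
        √((∑ i, |x i| ^ q.toReal) ^ (2 / q.toReal)) := by
      rw [Real.sqrt_eq_rpow, ← Real.rpow_mul (by positivity)]
      congr 1
      ring
    rw [hroot, mul_comm]
    refine (Real.sqrt_le_sqrt hJ).trans (le_of_eq ?_)
    rw [Real.sqrt_mul (by positivity), Real.sqrt_eq_rpow, ← Real.rpow_mul (by positivity)]
    congr 2
    ring

/-- **Hölder's inequality** for the dot product and conjugate exponents in `[1, ∞]`. -/
theorem abs_dotProduct_le_ellNorm_mul {p q : ENNReal} (hpq : p.HolderConjugate q)
    (w v : Fin d → ℝ) : |w ⬝ᵥ v| ≤ ellNorm q w * ellNorm p v := by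
  have hp := ENNReal.HolderConjugate.one_le p q
  have hq := ENNReal.HolderConjugate.one_le q p
  have habs : |w ⬝ᵥ v| ≤ ∑ i, |w i| * |v i| := by
    refine (Finset.abs_sum_le_sum_abs _ _).trans (le_of_eq ?_)
    simp [abs_mul]
  refine habs.trans ?_
  by_cases hp' : p = ⊤
  · have hq1 : q = 1 := (ENNReal.HolderConjugate.eq_top_iff_eq_one p q).1 hp'
    rw [hq1, ellNorm_one, Finset.sum_mul]
    gcongr with i
    exact abs_le_ellNorm hp v i
  by_cases hq' : q = ⊤
  · have hp1 : p = 1 := (ENNReal.HolderConjugate.eq_top_iff_eq_one q p).1 hq'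
    rw [hp1, ellNorm_one, Finset.mul_sum]
    gcongr with i
    exact abs_le_ellNorm hq w i
  have hr := (ENNReal.HolderConjugate.toReal_of_ne_top (p := p) (q := q) hp' hq').symm
  have := Real.inner_le_Lp_mul_Lq Finset.univ (fun i => |w i|) (fun i => |v i|) hr
  simpa only [abs_abs, ellNorm_eq_sum hp hp', ellNorm_eq_sum hq hq'] using this

end EllNorm

/-! ### The ramp loss -/

/-- The ramp loss. -/
noncomputable def rampLoss (t : ℝ) : ℝ := min 1 (max 0 (1 - t))

theorem rampLoss_nonneg (t : ℝ) : 0 ≤ rampLoss t := le_min zero_le_one (le_max_left _ _)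

theorem rampLoss_le_one (t : ℝ) : rampLoss t ≤ 1 := min_le_left _ _

theorem rampLoss_eq_one {t : ℝ} (ht : t ≤ 0) : rampLoss t = 1 :=
  min_eq_left (le_max_of_le_right (by linarith))

theorem rampLoss_eq_zero {t : ℝ} (ht : 1 ≤ t) : rampLoss t = 0 := by
  rw [rampLoss, max_eq_left (by linarith), min_eq_right zero_le_one]

theorem abs_rampLoss_sub_le (s t : ℝ) : |rampLoss s - rampLoss t| ≤ |s - t| := by
  refine (abs_min_sub_min_le_max _ _ _ _).trans (max_le (by simp) ?_)
  rw [max_comm 0, max_comm 0]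
  refine (abs_max_sub_max_le_abs _ _ _).trans (le_of_eq ?_)
  rw [sub_sub_sub_cancel_left, abs_sub_comm]

theorem Label.abs_eq_one (y : Label) : |(y : ℝ)| = 1 := by
  rcases y.2 with h | h <;> simp [h]

/-! ### From robust margins to shifted margins -/

section Margin

variable {d : ℕ}

/-- The margin of the halfspace `w` reduced by the offset `a`, for the parameter `(w, a)`. -/
def shiftedMargin (θ : (Fin d → ℝ) × ℝ) (z : Example d) : ℝ := z.2 * (θ.1 ⬝ᵥ z.1) - θ.2

theorem measurable_dotProduct_const (w : Fin d → ℝ) : Measurable fun x : Fin d → ℝ => w ⬝ᵥ x := by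
  unfold dotProduct
  fun_prop

theorem measurable_shiftedMargin (θ : (Fin d → ℝ) × ℝ) : Measurable (shiftedMargin θ) :=
  ((measurable_subtype_coe.comp measurable_snd).mul
    ((measurable_dotProduct_const θ.1).comp measurable_fst)).sub_const _

theorem continuous_shiftedMargin (z : Example d) :
    Continuous fun θ : (Fin d → ℝ) × ℝ => shiftedMargin θ z := by
  unfold shiftedMargin dotProduct
  fun_prop

theorem sum_rademacherSign_mul_shiftedMargin {m : ℕ} (σ : Fin m → Bool) (θ : (Fin d → ℝ) × ℝ)
    (S : Fin m → Example d) :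
    ∑ i, rademacherSign (σ i) * shiftedMargin θ (S i) =
      (θ.1 ⬝ᵥ fun j => ∑ i, rademacherSign (σ i) * (((S i).2 : ℝ) * (S i).1 j)) -
        θ.2 * ∑ i, rademacherSign (σ i) := by
  simp only [shiftedMargin, dotProduct, mul_sub, Finset.sum_sub_distrib, Finset.mul_sum]
  congr 1
  · rw [Finset.sum_comm]
    refine Finset.sum_congr rfl fun i _ => Finset.sum_congr rfl fun j _ => ?_
    ring
  · exact Finset.sum_congr rfl fun i _ => mul_comm _ _

/-- Linearity in `θ` separates the weight vector from the offset; Hölder bounds the first part, and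
the second is a scalar Rademacher sum. -/
theorem sum_rademacherSign_mul_shiftedMargin_le {p q : ENNReal} (hpq : p.HolderConjugate q)
    {m : ℕ} (σ : Fin m → Bool) {θ : (Fin d → ℝ) × ℝ} {W A : ℝ} (hW : ellNorm q θ.1 ≤ W)
    (h₀ : 0 ≤ θ.2) (hA : θ.2 ≤ A) (S : Fin m → Example d) :
    ∑ i, rademacherSign (σ i) * shiftedMargin θ (S i) ≤
      W * ellNorm p (fun j => ∑ i, rademacherSign (σ i) * (((S i).2 : ℝ) * (S i).1 j)) +
        A * |∑ i, rademacherSign (σ i)| := by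
  rw [sum_rademacherSign_mul_shiftedMargin, sub_eq_add_neg]
  refine add_le_add ?_ ?_
  · refine ((le_abs_self _).trans (abs_dotProduct_le_ellNorm_mul hpq _ _)).trans ?_
    exact mul_le_mul_of_nonneg_right hW (ellNorm_nonneg (ENNReal.HolderConjugate.one_le p q) _)
  · refine (neg_le_abs _).trans ?_
    rw [abs_mul, abs_of_nonneg h₀]
    gcongr

theorem rademacherAverage_shiftedMargin_le {p q : ENNReal} (hpq : p.HolderConjugate q)
    {ι : Type*} [Nonempty ι] {m : ℕ} {u : ι → (Fin d → ℝ) × ℝ} {W A Q : ℝ} (hW₀ : 0 ≤ W)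
    (hA₀ : 0 ≤ A) (hW : ∀ k, ellNorm q (u k).1 ≤ W) (h₀ : ∀ k, 0 ≤ (u k).2)
    (hA : ∀ k, (u k).2 ≤ A) (S : Fin m → Example d)
    (hQ : (∑ σ : Fin m → Bool,
      ellNorm p (fun j => ∑ i, rademacherSign (σ i) * (((S i).2 : ℝ) * (S i).1 j))) / 2 ^ m ≤ Q) :
    rademacherAverage (fun i k => shiftedMargin (u k) (S i)) ≤ W * Q + A * √(m : ℝ) := by
  refine (rademacherAverage_le_of_forall fun σ k =>
    sum_rademacherSign_mul_shiftedMargin_le hpq σ (hW k) (h₀ k) (hA k) S).trans ?_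
  rw [Finset.sum_add_distrib, ← Finset.mul_sum, ← Finset.mul_sum, add_div, mul_div_assoc,
    mul_div_assoc]
  gcongr
  exact sum_signs_abs_le m

/-- Massart's lemma, applied with `b σ` a coordinate attaining the sup norm; the labels do not
change absolute values. -/
theorem sum_signs_ellNorm_top_le (hd : 0 < d) {m : ℕ} (hm : 0 < m) (S : Fin m → Example d) :
    (∑ σ : Fin m → Bool,
      ellNorm ⊤ (fun j => ∑ i, rademacherSign (σ i) * (((S i).2 : ℝ) * (S i).1 j))) / 2 ^ m ≤
      √(m : ℝ) * (⨆ i, ellNorm ⊤ (S i).1) * √(2 * Real.log (2 * d)) := by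
  have : Nonempty (Fin d) := ⟨⟨0, hd⟩⟩
  choose b hb using fun σ : Fin m → Bool => exists_eq_ciSup_of_finite (f := fun j : Fin d =>
    |∑ i, rademacherSign (σ i) * (((S i).2 : ℝ) * (S i).1 j)|)
  refine le_trans ?_ (sum_signs_max_le hm (fun i j => ((S i).2 : ℝ) * (S i).1 j)
    (Real.iSup_nonneg fun i => ellNorm_nonneg le_top (S i).1) (fun i j => ?_) b)
  · refine div_le_div_of_nonneg_right (Finset.sum_le_sum fun σ _ => ?_) (by positivity)
    exact (hb σ).ge
  · rw [abs_mul, Label.abs_eq_one, one_mul]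
    exact (abs_le_ellNorm le_top _ j).trans
      (le_ciSup_of_finite (fun i => ellNorm ⊤ (S i).1) i)

theorem sum_signs_ellNorm_two_le {m : ℕ} (S : Fin m → Example d) :
    (∑ σ : Fin m → Bool,
      ellNorm 2 (fun j => ∑ i, rademacherSign (σ i) * (((S i).2 : ℝ) * (S i).1 j))) / 2 ^ m ≤
      √(m : ℝ) * ⨆ i, ellNorm 2 (S i).1 := by
  simp only [ellNorm_two]
  refine sum_signs_norm_two_le (fun i j => ((S i).2 : ℝ) * (S i).1 j)
    (Real.iSup_nonneg fun i => Real.sqrt_nonneg _) fun i => ?_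
  have h := le_ciSup_of_finite (fun i => √(∑ j, (S i).1 j ^ 2)) i
  have hy : ((S i).2 : ℝ) ^ 2 = 1 := by rw [← sq_abs, Label.abs_eq_one, one_pow]
  simp only [mul_pow, hy, one_mul]
  rw [← Real.sqrt_le_sqrt_iff (sq_nonneg _), Real.sqrt_sq (Real.iSup_nonneg fun i =>
    Real.sqrt_nonneg _)]
  exact h

variable {p q : ENNReal} {ε : ℝ}

theorem mem_perturbations_self (hp : 1 ≤ p) (hε : 0 ≤ ε) (x : Fin d → ℝ) :
    x ∈ perturbations p ε x := by
  simpa [perturbations, ellNorm_zero hp] using hε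

theorem add_mem_perturbations {x v : Fin d → ℝ} (hv : ellNorm p v ≤ ε) :
    x + v ∈ perturbations p ε x := by
  simpa [perturbations] using hv

theorem abs_dotProduct_sub_le (hpq : p.HolderConjugate q) (w : Fin d → ℝ) {x x' : Fin d → ℝ}
    (h : x' ∈ perturbations p ε x) : |w ⬝ᵥ (x' - x)| ≤ ellNorm q w * ε :=
  (abs_dotProduct_le_ellNorm_mul hpq _ _).trans
    (mul_le_mul_of_nonneg_left h (ellNorm_nonneg (ENNReal.HolderConjugate.one_le q p) _))

/-- Hölder bounds the inner products from below over the perturbations, so that the real infimum is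
a genuine lower bound and not the default value 0. -/
theorem robustMargin_le (hpq : p.HolderConjugate q) {m : ℕ} (S : Fin m → Example d)
    (w : Fin d → ℝ) (i : Fin m) {x' : Fin d → ℝ} (h : x' ∈ perturbations p ε (S i).1) :
    robustMargin p ε S w ≤ (S i).2 * (w ⬝ᵥ x') := by
  refine (ciInf_le (Set.finite_range _).bddBelow i).trans
    (ciInf_le (f := fun x' : perturbations p ε (S i).1 => ((S i).2 : ℝ) * (w ⬝ᵥ (x' : Fin d → ℝ)))
      ⟨-|w ⬝ᵥ (S i).1| - ellNorm q w * ε, ?_⟩ ⟨x', h⟩)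
  rintro _ ⟨⟨x, hx⟩, rfl⟩
  have h₁ := abs_dotProduct_sub_le hpq w hx
  rw [dotProduct_sub] at h₁
  have h₂ := neg_abs_le (((S i).2 : ℝ) * (w ⬝ᵥ x))
  rw [abs_mul, Label.abs_eq_one, one_mul] at h₂
  have h₃ := abs_sub_abs_le_abs_sub (w ⬝ᵥ x) (w ⬝ᵥ (S i).1)
  dsimp only
  linarith

theorem le_robustMargin (hp : 1 ≤ p) (hε : 0 ≤ ε) {m : ℕ} (hm : 0 < m) (S : Fin m → Example d)
    (w : Fin d → ℝ) {c : ℝ}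
    (h : ∀ i, ∀ x' ∈ perturbations p ε (S i).1, c ≤ (S i).2 * (w ⬝ᵥ x')) :
    c ≤ robustMargin p ε S w := by
  have : Nonempty (Fin m) := ⟨⟨0, hm⟩⟩
  refine le_ciInf fun i => ?_
  have : Nonempty (perturbations p ε (S i).1) := ⟨⟨_, mem_perturbations_self hp hε _⟩⟩
  exact le_ciInf fun x' => h i x' x'.2

/-- The worst-case loss of margin of `w` under perturbations. -/
noncomputable def marginLoss (p : ENNReal) (ε : ℝ) (w : Fin d → ℝ) : ℝ :=
  ⨆ v : {v : Fin d → ℝ // ellNorm p v ≤ ε}, w ⬝ᵥ (v : Fin d → ℝ)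

theorem dotProduct_le_of_ellNorm_le (hpq : p.HolderConjugate q) (w : Fin d → ℝ) {v : Fin d → ℝ}
    (hv : ellNorm p v ≤ ε) : w ⬝ᵥ v ≤ ellNorm q w * ε :=
  ((le_abs_self _).trans (abs_dotProduct_le_ellNorm_mul hpq _ _)).trans
    (mul_le_mul_of_nonneg_left hv (ellNorm_nonneg (ENNReal.HolderConjugate.one_le q p) _))

theorem dotProduct_le_marginLoss (hpq : p.HolderConjugate q) (w : Fin d → ℝ) {v : Fin d → ℝ}
    (hv : ellNorm p v ≤ ε) : w ⬝ᵥ v ≤ marginLoss p ε w :=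
  le_ciSup (f := fun v : {v : Fin d → ℝ // ellNorm p v ≤ ε} => w ⬝ᵥ (v : Fin d → ℝ))
    ⟨ellNorm q w * ε, by rintro _ ⟨v, rfl⟩; exact dotProduct_le_of_ellNorm_le hpq w v.2⟩ ⟨v, hv⟩

theorem marginLoss_nonneg (hpq : p.HolderConjugate q) (hε : 0 ≤ ε) (w : Fin d → ℝ) :
    0 ≤ marginLoss p ε w := by
  have h0 : ellNorm p (0 : Fin d → ℝ) ≤ ε := by
    rwa [ellNorm_zero (ENNReal.HolderConjugate.one_le p q)]
  simpa using dotProduct_le_marginLoss hpq w h0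

theorem marginLoss_le_of_forall (hp : 1 ≤ p) (hε : 0 ≤ ε) {w : Fin d → ℝ} {c : ℝ}
    (h : ∀ v : Fin d → ℝ, ellNorm p v ≤ ε → w ⬝ᵥ v ≤ c) : marginLoss p ε w ≤ c := by
  have : Nonempty {v : Fin d → ℝ // ellNorm p v ≤ ε} := ⟨⟨0, by rwa [ellNorm_zero hp]⟩⟩
  exact ciSup_le fun v => h v v.2

theorem ellNorm_label_smul (hp : 1 ≤ p) (y : Label) (v : Fin d → ℝ) :
    ellNorm p ((y : ℝ) • v) = ellNorm p v := by
  rw [ellNorm_smul hp, Label.abs_eq_one, one_mul]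

theorem Label.mul_self (y : Label) : (y : ℝ) * y = 1 := by
  rcases y.2 with h | h <;> simp [h]

/-- For `‖v‖_p ≤ ε` the point `x - y • v` is an admissible perturbation, and since `y * y = 1` its
margin is that of `x` minus `⟨w, v⟩`. -/
theorem one_le_shiftedMargin (hpq : p.HolderConjugate q) (hε : 0 ≤ ε) {m : ℕ}
    {S : Fin m → Example d} {w : Fin d → ℝ} (h : 1 ≤ robustMargin p ε S w) (i : Fin m) :
    1 ≤ shiftedMargin (w, marginLoss p ε w) (S i) := by
  have hp := ENNReal.HolderConjugate.one_le p q
  have : marginLoss p ε w ≤ (S i).2 * (w ⬝ᵥ (S i).1) - 1 := by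
    refine marginLoss_le_of_forall hp hε fun v hv => ?_
    have h' := h.trans (robustMargin_le hpq S w i (x' := (S i).1 + (-((S i).2 : ℝ)) • v)
      (add_mem_perturbations (by rw [neg_smul, ellNorm_neg hp, ellNorm_label_smul hp]; exact hv)))
    rw [dotProduct_add, dotProduct_smul, smul_eq_mul, mul_add, ← mul_assoc, mul_neg,
      Label.mul_self] at h'
    linarith
  simp only [shiftedMargin]
  linarith

/-- The vector `-y • (x' - x)` is admissible in the supremum defining `marginLoss`. -/
theorem shiftedMargin_nonpos (hpq : p.HolderConjugate q) {w : Fin d → ℝ}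
    {z : Example d} {x' : Fin d → ℝ} (hx' : x' ∈ perturbations p ε z.1)
    (h : (z.2 : ℝ) * (w ⬝ᵥ x') ≤ 0) : shiftedMargin (w, marginLoss p ε w) z ≤ 0 := by
  have hp := ENNReal.HolderConjugate.one_le p q
  have h' := dotProduct_le_marginLoss (ε := ε) hpq w (v := (-(z.2 : ℝ)) • (x' - z.1))
    (by rw [neg_smul, ellNorm_neg hp, ellNorm_label_smul hp]; exact hx')
  rw [dotProduct_smul, smul_eq_mul, dotProduct_sub] at h'
  simp only [shiftedMargin]
  linarith

/-- A pointwise comparison. Only the ramp side has to be integrable, so measurability of the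
worst-case indicator never enters. -/
theorem robustRisk01_le_integral_rampLoss (hpq : p.HolderConjugate q)
    (D : Measure (Example d)) [IsProbabilityMeasure D] (w : Fin d → ℝ) :
    robustRisk01 D p ε w ≤ ∫ z, rampLoss (shiftedMargin (w, marginLoss p ε w) z) ∂D := by
  have hramp : Continuous rampLoss := by unfold rampLoss; fun_prop
  refine integral_mono_of_nonneg (Filter.Eventually.of_forall fun z =>
    Real.iSup_nonneg fun x' => by split_ifs <;> norm_num)
    (Integrable.of_bound (hramp.measurable.comp (measurable_shiftedMargin _)).aestronglyMeasurable 1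
      (Filter.Eventually.of_forall fun z => ?_)) (Filter.Eventually.of_forall fun z => ?_)
  · rw [Real.norm_of_nonneg (rampLoss_nonneg _)]
    exact rampLoss_le_one _
  · refine Real.iSup_le (fun x' => ?_) (rampLoss_nonneg _)
    split_ifs with h
    · exact (rampLoss_eq_one (shiftedMargin_nonpos hpq x'.2 h)).ge
    · exact rampLoss_nonneg _

theorem robustRisk01_smul (D : Measure (Example d)) (w : Fin d → ℝ) {c : ℝ} (hc : 0 < c) :
    robustRisk01 D p ε (c • w) = robustRisk01 D p ε w := by
  have : ∀ (y : ℝ) (x : Fin d → ℝ), y * (c • w ⬝ᵥ x) ≤ 0 ↔ y * (w ⬝ᵥ x) ≤ 0 := fun y x => by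
    rw [smul_dotProduct, smul_eq_mul, mul_left_comm]
    exact ⟨fun h => nonpos_of_mul_nonpos_right h hc, mul_nonpos_of_nonneg_of_nonpos hc.le⟩
  simp only [robustRisk01, this]

end Margin

/-! ### Events of high probability -/

section HoldsWithProb

variable {d m : ℕ} {D : Measure (Example d)} {a : ℝ}

theorem HoldsWithProb.mono {P P' : (Fin m → Example d) → Prop} (h : HoldsWithProb m D a P)
    (hP : ∀ S, P S → P' S) : HoldsWithProb m D a P' := by
  obtain ⟨E, hE, ha, hES⟩ := h
  exact ⟨E, hE, ha, fun S hS => hP S (hES S hS)⟩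

/-- The samples with a bad example form a null set, perhaps not measurable; a measurable null
superset is removed from the event. -/
theorem HoldsWithProb.and_forall_of_ae [IsProbabilityMeasure D] {P : (Fin m → Example d) → Prop}
    (h : HoldsWithProb m D a P) {good : Example d → Prop} (hgood : ∀ᵐ z ∂D, good z) :
    HoldsWithProb m D a fun S => P S ∧ ∀ i, good (S i) := by
  obtain ⟨E, hE, ha, hES⟩ := h
  have hae : ∀ᵐ S ∂Measure.pi (fun _ : Fin m => D), ∀ i, good (S i) := ae_all_iff.2 fun i =>
    (measurePreserving_eval (fun _ : Fin m => D) i).quasiMeasurePreserving.ae hgood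
  obtain ⟨T, hT, hTm, hT₀⟩ := exists_measurable_superset_of_null (ae_iff.1 hae)
  refine ⟨E \ T, hE.diff hTm, ?_, fun S hS => ⟨hES S hS.1, ?_⟩⟩
  · rwa [measure_sdiff_null hT₀]
  · by_contra hc
    exact hS.2 (hT hc)

end HoldsWithProb

/-! ### The margin bound over a ball and its use for maximizers -/

section Generalization

variable {d m : ℕ} {p q r r' : ENNReal} {ε δ : ℝ}

/-- The margin-based generalization bound over an `ℓ_r` ball, from a bound `Q` on the Rademacher
complexity of linear functions over the unit ball and a bound `κ` on the `ℓ_q` norm there. -/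
theorem holdsWithProb_robustRisk01_le (hm : 0 < m) (hpq : p.HolderConjugate q)
    (hrr' : r'.HolderConjugate r) (hε : 0 ≤ ε) (D : Measure (Example d)) [IsProbabilityMeasure D]
    {W κ : ℝ} (hW : 0 ≤ W) (hκ₀ : 0 ≤ κ)
    (hκ : ∀ w : Fin d → ℝ, ellNorm q w ≤ ellNorm r w * κ) {Q : (Fin m → Example d) → ℝ}
    (hQm : Measurable Q) (hQ : ∀ S : Fin m → Example d, (∑ σ : Fin m → Bool,
      ellNorm r' (fun j => ∑ i, rademacherSign (σ i) * (((S i).2 : ℝ) * (S i).1 j))) / 2 ^ m ≤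
        √(m : ℝ) * Q S) (hδ : 0 < δ) :
    HoldsWithProb m D (1 - δ) fun S => ∀ w, ellNorm r w ≤ W → 1 ≤ robustMargin p ε S w →
      robustRisk01 D p ε w ≤ 2 / √(m : ℝ) * (Q S * W + ε * W * κ) +
        3 * √(Real.log (2 / δ) / (2 * m)) := by
  have hp := ENNReal.HolderConjugate.one_le p q
  have hr := ENNReal.HolderConjugate.one_le r r'
  -- For `δ > 1` the required probability is not positive and the empty event suffices.
  rcases le_or_gt δ 1 with hδ₁ | hδ₁
  swap
  · exact ⟨∅, MeasurableSet.empty, by simp [ENNReal.ofReal_of_nonpos (by linarith : 1 - δ ≤ 0)],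
      fun S hS => hS.elim⟩
  have hA : 0 ≤ ε * W * κ := by positivity
  have hm' : (0 : ℝ) < m := by exact_mod_cast hm
  have : Nonempty {θ : (Fin d → ℝ) × ℝ // ellNorm r θ.1 ≤ W ∧ 0 ≤ θ.2 ∧ θ.2 ≤ ε * W * κ} :=
    ⟨⟨0, by simpa [ellNorm_zero hr] using hW, le_rfl, hA⟩⟩
  -- The offset is a parameter independent of `w`, so the class is linear in `θ`; `a = marginLoss p
  -- ε w` is substituted only afterwards.
  obtain ⟨E, hE, hEδ, hES⟩ := exists_measurableSet_forall_deviation D hm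
    (f := fun θ : {θ : (Fin d → ℝ) × ℝ // ellNorm r θ.1 ≤ W ∧ 0 ≤ θ.2 ∧ θ.2 ≤ ε * W * κ} =>
      shiftedMargin θ.1)
    (fun θ => measurable_shiftedMargin _)
    (fun z => (continuous_shiftedMargin z).comp continuous_subtype_val)
    abs_rampLoss_sub_le rampLoss_nonneg rampLoss_le_one
    (R := fun S => W * (√(m : ℝ) * Q S) + ε * W * κ * √(m : ℝ)) (by fun_prop)
    (fun N u S => rademacherAverage_shiftedMargin_le hrr' hW hA (fun k => (u k).2.1)
      (fun k => (u k).2.2.1) (fun k => (u k).2.2.2) S (hQ S)) hδ hδ₁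
  refine ⟨E, hE, hEδ, fun S hS w hw hmargin => ?_⟩
  have hloss : marginLoss p ε w ≤ ε * W * κ :=
    marginLoss_le_of_forall hp hε fun v hv => (dotProduct_le_of_ellNorm_le hpq w hv).trans <| by
      calc ellNorm q w * ε ≤ W * κ * ε := by
            gcongr
            exact (hκ w).trans (by gcongr)
        _ = ε * W * κ := by ring
  have key := hES S hS ⟨(w, marginLoss p ε w), hw, marginLoss_nonneg hpq hε w, hloss⟩
  simp only [rampLoss_eq_zero (one_le_shiftedMargin hpq hε hmargin _), Finset.sum_const_zero,
    zero_add] at key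
  refine (robustRisk01_le_integral_rampLoss hpq D w).trans ?_
  -- The deviation bound holds with `log (1 / δ)`; it is weakened here to `log (2 / δ)`.
  have hlog : √(m * Real.log (1 / δ) / 2) ≤ m * √(Real.log (2 / δ) / (2 * m)) := by
    refine Real.sqrt_le_iff.2 ⟨by positivity, ?_⟩
    have h2 : Real.log (1 / δ) ≤ Real.log (2 / δ) :=
      Real.log_le_log (by positivity) (by gcongr; norm_num)
    have h0 : 0 ≤ Real.log (1 / δ) := Real.log_nonneg (by rw [le_div_iff₀ hδ]; linarith)
    rw [mul_pow, Real.sq_sqrt (div_nonneg (h0.trans h2) (by positivity))]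
    have : (m : ℝ) ^ 2 * (Real.log (2 / δ) / (2 * m)) = m * Real.log (2 / δ) / 2 := by
      field_simp
    rw [this]
    gcongr
  have hsqrt : (m : ℝ) * (2 / √(m : ℝ) * (Q S * W + ε * W * κ)) =
      2 * (W * (√(m : ℝ) * Q S) + ε * W * κ * √(m : ℝ)) := by
    have hs : √(m : ℝ) ≠ 0 := (Real.sqrt_pos.2 hm').ne'
    nth_rewrite 1 [← Real.mul_self_sqrt hm'.le]
    field_simp
  refine le_of_mul_le_mul_left ?_ hm'
  rw [mul_add, hsqrt]
  linarith

/-- The normalized `v` competes in the unit ball with robust margin at least `1 / ‖v‖_r`, so the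
maximizer `w` does at least as well. -/
theorem one_le_robustMargin_smul (hpq : p.HolderConjugate q) (hr : 1 ≤ r) (hε : 0 ≤ ε)
    (hm : 0 < m) {S : Fin m → Example d} {v w : Fin d → ℝ} (hv : 0 < ellNorm r v)
    (hvS : ∀ i, ∀ x' ∈ perturbations p ε (S i).1, 1 ≤ ((S i).2 : ℝ) * (v ⬝ᵥ x'))
    (hw : w ∈ maxMarginVectors r p ε S) : 1 ≤ robustMargin p ε S (ellNorm r v • w) := by
  have hp := ENNReal.HolderConjugate.one_le p q
  have hinv : (ellNorm r v)⁻¹ ≤ robustMargin p ε S ((ellNorm r v)⁻¹ • v) :=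
    le_robustMargin hp hε hm S _ fun i x' hx' => by
      rw [smul_dotProduct, smul_eq_mul, mul_left_comm]
      exact le_mul_of_one_le_right (inv_pos.2 hv).le (hvS i x' hx')
  have hunit : (ellNorm r v)⁻¹ • v ∈ {v : Fin d → ℝ | ellNorm r v ≤ 1} := by
    simp only [Set.mem_ofPred_eq, ellNorm_smul hr]
    rw [abs_of_pos (inv_pos.2 hv), inv_mul_cancel₀ hv.ne']
  have hmax : (ellNorm r v)⁻¹ ≤ robustMargin p ε S w := hinv.trans (hw.2 hunit)
  refine le_robustMargin hp hε hm S _ fun i x' hx' => ?_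
  rw [smul_dotProduct, smul_eq_mul, mul_left_comm, ← inv_le_iff_one_le_mul₀' hv]
  exact hmax.trans (robustMargin_le hpq S w i hx')

/-- The margin-based bound applies to the maximizers of the robust margin over the unit ball, whose
multiples by the norm of the teacher have robust margin at least one. -/
theorem HoldsWithProb.maxMarginUnit_of_robustMargin (hm : 0 < m) (hpq : p.HolderConjugate q)
    (hr : 1 ≤ r) (hε : 0 ≤ ε) {D : Measure (Example d)} [IsProbabilityMeasure D] {a : ℝ}
    {wstar : Fin d → ℝ}
    (hmargin : ∀ᵐ z ∂D, ∀ x' ∈ perturbations p ε z.1, 1 ≤ (z.2 : ℝ) * (wstar ⬝ᵥ x'))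
    {B : (Fin m → Example d) → ℝ}
    (h : HoldsWithProb m D a fun S => ∀ w, ellNorm r w ≤ ellNorm r wstar →
      1 ≤ robustMargin p ε S w → robustRisk01 D p ε w ≤ B S) :
    HoldsWithProb m D a fun S => ∀ w ∈ maxMarginUnit r p ε wstar S,
      robustRisk01 D p ε w ≤ B S := by
  have hp := ENNReal.HolderConjugate.one_le p q
  -- A zero teacher would have margin 0 at every point.
  have hpos : 0 < ellNorm r wstar := by
    obtain ⟨z, hz⟩ := hmargin.exists
    refine (ellNorm_nonneg hr _).lt_of_ne' fun h0 => ?_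
    have := hz _ (mem_perturbations_self hp hε _)
    rw [ellNorm_eq_zero hr h0, zero_dotProduct, mul_zero] at this
    linarith
  refine (h.and_forall_of_ae hmargin).mono fun S hS w hw => ?_
  rw [← robustRisk01_smul D w hpos]
  refine hS.1 _ ?_ (one_le_robustMargin_smul hpq hr hε hm hpos hS.2 hw.2)
  rw [ellNorm_smul hr, abs_of_pos hpos]
  exact mul_le_of_le_one_right hpos.le hw.2.1

theorem measurable_iSup_ellNorm (hr : 1 ≤ r) :
    Measurable fun S : Fin m → Example d => ⨆ i, ellNorm r (S i).1 :=
  Measurable.iSup fun i =>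
    (measurable_ellNorm hr).comp (measurable_fst.comp (measurable_pi_apply i))

end Generalization

/-! ### Specialization to `r = 1` and `r = 2` -/

theorem proposition3p2 (d m : ℕ) (hm : 0 < m) (p q : ENNReal) (hpq : p.HolderConjugate q)
    (ε : ℝ) (hε : 0 ≤ ε) (D : Measure (Example d)) (hD : IsProbabilityMeasure D)
    (wstar : Fin d → ℝ)
    (hteacher : ∀ᵐ z ∂D, ∀ x' ∈ perturbations p ε z.1, (z.2 : ℝ) = Real.sign (wstar ⬝ᵥ x'))
    (δ : ℝ) (hδ : 0 < δ) :
    (HoldsWithProb m D (1 - δ) (fun S => ∀ w ∈ maxMarginInterpolators 1 p ε wstar S,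
        robustRisk01 D p ε w ≤ robustBoundOne ε wstar δ S) ∧
      HoldsWithProb m D (1 - δ) (fun S => ∀ w ∈ maxMarginInterpolators 2 p ε wstar S,
        robustRisk01 D p ε w ≤ robustBoundTwo q ε wstar δ S)) ∧
    ((∀ᵐ z ∂D, ∀ x' ∈ perturbations p ε z.1, 1 ≤ (z.2 : ℝ) * (wstar ⬝ᵥ x')) →
      HoldsWithProb m D (1 - δ) (fun S => ∀ w ∈ maxMarginUnit 1 p ε wstar S,
        robustRisk01 D p ε w ≤ robustBoundOne ε wstar δ S) ∧
      HoldsWithProb m D (1 - δ) (fun S => ∀ w ∈ maxMarginUnit 2 p ε wstar S,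
        robustRisk01 D p ε w ≤ robustBoundTwo q ε wstar δ S)) := by
  have hp := ENNReal.HolderConjugate.one_le p q
  have hq := ENNReal.HolderConjugate.one_le q p
  -- In dimension 0 every inner product is 0, and `Real.sign 0 = 0` is not a label. Massart's lemma
  -- needs a coordinate to choose.
  have hd : 0 < d := by
    by_contra h
    obtain rfl : d = 0 := by lia
    obtain ⟨z, hz⟩ := hteacher.exists
    have hy := hz _ (mem_perturbations_self hp hε _)
    have := Label.abs_eq_one z.2
    simp [hy] at this
  have bound₁ : HoldsWithProb m D (1 - δ) fun S => ∀ w, ellNorm 1 w ≤ ellNorm 1 wstar →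
      1 ≤ robustMargin p ε S w → robustRisk01 D p ε w ≤ robustBoundOne ε wstar δ S := by
    -- Here `κ = 1`, since `‖w‖_q ≤ ‖w‖_1` for every `q ≥ 1`.
    refine (holdsWithProb_robustRisk01_le hm hpq (r := 1) (r' := ⊤) inferInstance hε D
      (ellNorm_nonneg le_rfl wstar) zero_le_one (fun w => by simpa using ellNorm_anti le_rfl hq w)
      (Q := fun S => (⨆ i, ellNorm ⊤ (S i).1) * √(2 * Real.log (2 * d)))
      ((measurable_iSup_ellNorm le_top).mul_const _)
      (fun S => by simpa only [mul_assoc] using sum_signs_ellNorm_top_le hd hm S) hδ).mono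
      fun S hS w hw hmargin => (hS w hw hmargin).trans (le_of_eq ?_)
    rw [robustBoundOne]
    ring
  have bound₂ : HoldsWithProb m D (1 - δ) fun S => ∀ w, ellNorm 2 w ≤ ellNorm 2 wstar →
      1 ≤ robustMargin p ε S w → robustRisk01 D p ε w ≤ robustBoundTwo q ε wstar δ S :=
    holdsWithProb_robustRisk01_le hm hpq (r := 2) (r' := 2) inferInstance hε D
      (ellNorm_nonneg one_le_two wstar) (by positivity) (ellNorm_le_ellNorm_two_mul hq)
      (Q := fun S => ⨆ i, ellNorm 2 (S i).1) (measurable_iSup_ellNorm one_le_two)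
      sum_signs_ellNorm_two_le hδ
  exact ⟨⟨bound₁.mono fun S hS w hw => hS w hw.1 hw.2.1,
      bound₂.mono fun S hS w hw => hS w hw.1 hw.2.1⟩, fun hmargin =>
    ⟨bound₁.maxMarginUnit_of_robustMargin hm hpq le_rfl hε hmargin,
      bound₂.maxMarginUnit_of_robustMargin hm hpq one_le_two hε hmargin⟩⟩
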